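/- Let $M_2(\mathbb C)$ be the space of complex $2\times 2$ matrices with the spectral norm (the operator norm induced by the Euclidean norm on $\mathbb C^2$), and let $U_2(\mathbb C)$ be the group of $2\times2$ unitary matrices. Matrices $A,B\in M_2(\mathbb C)$ form a triangle equality attaining (TEA) pair if $\|A+B\|=\|A\|+\|B\|$, and a parallel pair if $\|A+\mu B\|=\|A\|+\|B\|$ for some $\mu\in\mathbb C$ with $|\mu|=1$. A map $T$ preserves TEA (resp. parallel) pairs if $T(A),T(B)$ form a TEA (resp. parallel) pair whenever $A,B$ do. Let $$\mathcal C_1=\begin{pmatrix}1&0\\0&-1\end{pmatrix},\quad \mathcal C_2=\begin{pmatrix}0&1\\1&0\end{pmatrix},\quad \mathcal C_3=\begin{pmatrix}0&-i\\i&0\end{pmatrix},$$ and let $\mathbf C=(I_2/\sqrt2,\ \mathcal C_1/\sqrt2,\ \mathcal C_2/\sqrt2,\ \mathcal C_3/\sqrt2)$, an ordered basis of $M_2(\mathbb C)$ which is orthonormal for $\langle A,B\rangle=\operatorname{trace}(B^*A)$. Theorem. Let $T:M_2(\mathbb C)\to M_2(\mathbb C)$ be a complex linear map. (a) $T$ preserves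 TEA pairs if and only if there are $\gamma\ge 0$ and $U,V\in U_2(\mathbb C)$ such that $T$ has the form $A\mapsto\gamma UAV$ or the form $A\mapsto\gamma UA^{\mathrm t}V$. (b) $T$ preserves parallel pairs if and only if one of the following holds. (b.1) There are $F,Z\in M_2(\mathbb C)$ such that $T(A)=\operatorname{trace}(FA)\,Z$ for all $A$. (b.2) There are $U_1,U_2,V_1,V_2\in U_2(\mathbb C)$ and real scalars $d_0,d_1,d_2,d_3,\gamma_1,\gamma_2,\gamma_3$ such that the matrix, with respect to the basis $\mathbf C$, of the linear map $\tilde T:A\mapsto U_1T(U_2AV_2)V_1$ is $$[\tilde T]_{\mathbf C}=\begin{pmatrix}d_0&\gamma_1 i&\gamma_2 i&\gamma_3 i\\0&d_1&0&0\\0&0&d_2&0\\0&0&0&d_3\end{pmatrix}.$$ -/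

import Mathlib

-- Matrices carry the spectral norm, i.e. the operator norm for the Euclidean norms.
open scoped Matrix.Norms.L2Operator

/-- `x` and `y` are parallel: `‖x + μ y‖ = ‖x‖ + ‖y‖` for some unimodular scalar `μ`. -/
def IsParallelPair (𝕜 : Type*) {E : Type*} [RCLike 𝕜] [NormedAddCommGroup E] [NormedSpace 𝕜 E]
    (x y : E) : Prop :=
  ∃ μ : 𝕜, ‖μ‖ = 1 ∧ ‖x + μ • y‖ = ‖x‖ + ‖y‖

/-- `x` and `y` form a triangle equality attaining (TEA) pair. -/
def IsTEAPair {E : Type*} [NormedAddCommGroup E] (x y : E) : Prop :=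
  ‖x + y‖ = ‖x‖ + ‖y‖

/-- The complex linear map `T` sends parallel pairs to parallel pairs (spectral norm). -/
def PreservesParallelPairs
    (T : Matrix (Fin 2) (Fin 2) ℂ →ₗ[ℂ] Matrix (Fin 2) (Fin 2) ℂ) : Prop :=
  ∀ A B : Matrix (Fin 2) (Fin 2) ℂ, IsParallelPair ℂ A B → IsParallelPair ℂ (T A) (T B)

/-- The complex linear map `T` sends TEA pairs to TEA pairs (spectral norm). -/
def PreservesTEAPairs
    (T : Matrix (Fin 2) (Fin 2) ℂ →ₗ[ℂ] Matrix (Fin 2) (Fin 2) ℂ) : Prop :=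
  ∀ A B : Matrix (Fin 2) (Fin 2) ℂ, IsTEAPair A B → IsTEAPair (T A) (T B)

/-- The linear map `A ↦ U * T (U' * A * V') * V`. -/
def twoSidedTransform
    (U U' V V' : Matrix (Fin 2) (Fin 2) ℂ)
    (T : Matrix (Fin 2) (Fin 2) ℂ →ₗ[ℂ] Matrix (Fin 2) (Fin 2) ℂ) :
    Matrix (Fin 2) (Fin 2) ℂ →ₗ[ℂ] Matrix (Fin 2) (Fin 2) ℂ where
  toFun A := U * T (U' * A * V') * V
  map_add' A B := by simp [mul_add, add_mul]
  map_smul' c A := by simp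

/-- The identity and the three Pauli matrices, `I₂, C₁, C₂, C₃`. -/
def pauli : Fin 4 → Matrix (Fin 2) (Fin 2) ℂ :=
  ![1, !![1, 0; 0, -1], !![0, 1; 1, 0], !![0, -Complex.I; Complex.I, 0]]

/-- The normalized family `I₂/√2, C₁/√2, C₂/√2, C₃/√2`. -/
noncomputable def normalizedPauli (k : Fin 4) : Matrix (Fin 2) (Fin 2) ℂ :=
  ((Real.sqrt 2 : ℝ) : ℂ)⁻¹ • pauli k

/-- The normalized family is orthonormal for the inner product `⟨A, B⟩ = trace (B* A)`. -/
theorem normalizedPauli_orthonormal (j k : Fin 4) :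
    ((normalizedPauli k).conjTranspose * normalizedPauli j).trace = if j = k then 1 else 0 := by
  have h2 : ((Real.sqrt 2 : ℝ) : ℂ)⁻¹ * ((Real.sqrt 2 : ℝ) : ℂ)⁻¹ = 1 / 2 := by
    rw [← mul_inv, ← Complex.ofReal_mul, Real.mul_self_sqrt (by norm_num)]
    norm_num
  have h : ((pauli k).conjTranspose * pauli j).trace = if j = k then 2 else 0 := by
    fin_cases j <;> fin_cases k <;>
      simp [pauli, Matrix.trace, Matrix.mul_apply, Fin.sum_univ_two] <;> norm_num
  simp only [normalizedPauli, Matrix.conjTranspose_smul, Matrix.smul_mul, Matrix.mul_smul,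
    Matrix.trace_smul, h, smul_eq_mul, star_inv₀, Complex.star_def, Complex.conj_ofReal,
    ← mul_assoc, h2]
  split_ifs <;> norm_num

theorem normalizedPauli_linearIndependent : LinearIndependent ℂ normalizedPauli := by
  rw [Fintype.linearIndependent_iff]
  intro g hg k
  have h := congrArg (fun A => ((normalizedPauli k).conjTranspose * A).trace) hg
  simpa [Matrix.mul_sum, Matrix.trace_sum, normalizedPauli_orthonormal] using h

/-- The ordered basis `(I₂/√2, C₁/√2, C₂/√2, C₃/√2)` of `M₂(ℂ)`. -/
noncomputable def pauliBasis : Module.Basis (Fin 4) ℂ (Matrix (Fin 2) (Fin 2) ℂ) :=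
  basisOfLinearIndependentOfCardEqFinrank normalizedPauli_linearIndependent
    (by simp [Module.finrank_matrix])

theorem pauliBasis_apply (k : Fin 4) : pauliBasis k = normalizedPauli k := by
  simp [pauliBasis]

/-! Let H be the quaternions inside M₂(ℂ), the real span of 1, iC₁, iC₂, iC₃, so that M₂(ℂ) = H ⊕
iH. A pair is parallel exactly when both matrices attain their norms at a common unit vector with
images on a common complex line; for 2×2 matrices this is a simultaneous singular value
decomposition with the dominant entries in the same place (`IsTEAPair.exists_svd`,
`IsParallelPair.eq_diag`). Elements of H have equal singular values, and any two of them diagonalize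
simultaneously (`exists_simultaneous_diag`), hence are parallel.

The core is a dichotomy for maps preserving parallel pairs
(`PreservesParallelPairs.rank_one_or_real`). If some quaternion has an image with distinct singular
values, that image forces the whole range into a common diagonal form and then into a line
(`exists_rank_one_of_generic`). Otherwise T commutes with `quatConj` up to a scalar, unless its rank
is at most one, and a phase makes T map H to H. Conversely every map sending H to H preserves
parallel pairs (`preservesParallelPairs_of_quatConj`).

Identify H with Euclidean ℝ⁴. Its isometries are products of reflections, hence two-sided unitary
multiplications, possibly with a transposition. For (b), the real singular value decomposition of T
on H gives the matrix form. For (a), orthogonality of X, Y in H means that X and iY form a TEA pair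
(`isTEAPair_quat_iff`), so T preserves orthogonality and is a multiple of an isometry; nonzero
rank-one maps are excluded separately. -/

/-! ### Norm attainment and diagonal matrices -/

/-- In finite dimension, equality in the triangle inequality for two operators is witnessed by a
common norm-attaining vector with a common direction of the images. -/
theorem ContinuousLinearMap.exists_common_direction {E F : Type*}
    [NormedAddCommGroup E] [NormedSpace ℂ E] [FiniteDimensional ℂ E] [Nontrivial E]
    [NormedAddCommGroup F] [InnerProductSpace ℂ F] [Nontrivial F] (f g : E →L[ℂ] F)
    (h : ‖f + g‖ = ‖f‖ + ‖g‖) :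
    ∃ x : E, ∃ y : F, ‖x‖ = 1 ∧ ‖y‖ = 1 ∧ f x = (‖f‖ : ℂ) • y ∧ g x = (‖g‖ : ℂ) • y := by
  have : ProperSpace E := FiniteDimensional.proper ℂ E
  obtain ⟨x, hx, hmax⟩ := (isCompact_sphere (0 : E) 1).exists_isMaxOn
    (NormedSpace.sphere_nonempty.mpr zero_le_one) ((f + g).continuous.norm.continuousOn)
  have hx1 : ‖x‖ = 1 := by simpa using hx
  have hn : ‖f + g‖ ≤ ‖(f + g) x‖ := by
    refine ContinuousLinearMap.opNorm_le_of_unit_norm (𝕜 := ℂ) (norm_nonneg _) fun z hz => ?_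
    exact hmax (by simpa using hz)
  have hf := f.le_opNorm x
  have hg := g.le_opNorm x
  have hadd : ‖(f + g) x‖ ≤ ‖f x‖ + ‖g x‖ := norm_add_le _ _
  rw [hx1, mul_one] at hf hg
  have hfx : ‖f x‖ = ‖f‖ := by linarith
  have hgx : ‖g x‖ = ‖g‖ := by linarith
  have hfg : ‖f x + g x‖ = ‖f x‖ + ‖g x‖ := le_antisymm hadd (by
    rw [hfx, hgx, ← h]; exact hn)
  -- Strict convexity of the real inner product space puts `f x` and `g x` on one ray; if both
  -- vanish, any unit vector serves as `y`.
  let : InnerProductSpace ℝ F := InnerProductSpace.rclikeToReal ℂ F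
  have hray : SameRay ℝ (f x) (g x) := sameRay_iff_norm_add.mpr hfg
  by_cases h0 : f x + g x = 0
  · obtain ⟨y, hy⟩ := exists_norm_eq F (zero_le_one (α := ℝ))
    have : ‖f x‖ + ‖g x‖ = 0 := by rw [← hfg, h0, norm_zero]
    have h1 : ‖f x‖ = 0 := by linarith [norm_nonneg (f x), norm_nonneg (g x)]
    have h2 : ‖g x‖ = 0 := by linarith [norm_nonneg (f x), norm_nonneg (g x)]
    refine ⟨x, y, hx1, hy, ?_, ?_⟩
    · rw [← hfx, h1, norm_eq_zero.mp h1]; simp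
    · rw [← hgx, h2, norm_eq_zero.mp h2]; simp
  · have hpos : ‖f x + g x‖ ≠ 0 := norm_ne_zero_iff.mpr h0
    have e1 := (SameRay.rfl.add_right hray).norm_smul_eq
    have e2 := (hray.symm.add_right SameRay.rfl).norm_smul_eq
    refine ⟨x, ((‖f x + g x‖⁻¹ : ℝ) : ℂ) • (f x + g x), hx1, ?_, ?_, ?_⟩
    · rw [norm_smul, Complex.norm_real, norm_inv, norm_norm, inv_mul_cancel₀ hpos]
    · rw [← hfx, smul_comm, Complex.coe_smul, Complex.coe_smul, e1, inv_smul_smul₀ hpos]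
    · rw [← hgx, smul_comm, Complex.coe_smul, Complex.coe_smul, e2, inv_smul_smul₀ hpos]

/-- The space of complex `2 × 2` matrices. -/
abbrev M2 := Matrix (Fin 2) (Fin 2) ℂ

theorem norm_unitary_mul_mul {U V : M2} (hU : U ∈ Matrix.unitaryGroup (Fin 2) ℂ)
    (hV : V ∈ Matrix.unitaryGroup (Fin 2) ℂ) (A : M2) : ‖U * A * V‖ = ‖A‖ := by
  rw [CStarRing.norm_mul_mem_unitary _ hV, CStarRing.norm_mem_unitary_mul _ hU]

theorem norm_diag (a b : ℂ) : ‖!![a, 0; 0, b]‖ = max ‖a‖ ‖b‖ := by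
  have : !![a, 0; 0, b] = Matrix.diagonal ![a, b] := by
    ext i j; fin_cases i <;> fin_cases j <;> simp
  rw [this, Matrix.l2_opNorm_diagonal]
  apply le_antisymm
  · rw [pi_norm_le_iff_of_nonneg (by positivity)]
    intro i; fin_cases i <;> simp
  · exact max_le (norm_le_pi_norm ![a, b] 0) (norm_le_pi_norm ![a, b] 1)

theorem norm_sq_col_le (A : M2) (j : Fin 2) : ‖A 0 j‖ ^ 2 + ‖A 1 j‖ ^ 2 ≤ ‖A‖ ^ 2 := by
  have h := A.l2_opNorm_mulVec (EuclideanSpace.single j 1)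
  have h2 := pow_le_pow_left₀ (norm_nonneg _) h 2
  rw [EuclideanSpace.norm_sq_eq] at h2
  simpa [Fin.sum_univ_two] using h2

theorem norm_sq_row_le (A : M2) (i : Fin 2) : ‖A i 0‖ ^ 2 + ‖A i 1‖ ^ 2 ≤ ‖A‖ ^ 2 := by
  rw [← Matrix.l2_opNorm_conjTranspose]
  simpa using norm_sq_col_le A.conjTranspose i

/-- A matrix attaining its norm at a multiple of the first basis vector, with the image in the same
direction, is diagonal. -/
theorem eq_diag_of_norm_le {A : M2} (h : A 1 0 = 0) (hn : ‖A‖ ≤ ‖A 0 0‖) :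
    A = !![A 0 0, 0; 0, A 1 1] ∧ ‖A 1 1‖ ≤ ‖A 0 0‖ := by
  have h1 := norm_sq_row_le A 0
  have h2 := norm_sq_col_le A 1
  have h3 : ‖A‖ ^ 2 ≤ ‖A 0 0‖ ^ 2 := pow_le_pow_left₀ (norm_nonneg _) hn 2
  have h4 : A 0 1 = 0 := by
    rw [← norm_eq_zero, ← sq_eq_zero_iff]
    nlinarith [sq_nonneg ‖A 0 1‖]
  constructor
  · ext i j; fin_cases i <;> fin_cases j <;> simp [h, h4]
  · exact abs_le_of_sq_le_sq' (by nlinarith [sq_nonneg ‖A 0 1‖]) (norm_nonneg _) |>.2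

/-! ### The quaternionic structure and SU(2) -/

/-- The conjugate-linear multiplicative involution of `M₂(ℂ)` whose fixed points are the
quaternions. -/
def quatConj (A : M2) : M2 := !![star (A 1 1), -star (A 1 0); -star (A 0 1), star (A 0 0)]

theorem quatConj_add (A B : M2) : quatConj (A + B) = quatConj A + quatConj B := by
  ext i j; fin_cases i <;> fin_cases j <;> simp [quatConj] <;> ring

theorem quatConj_smul (c : ℂ) (A : M2) : quatConj (c • A) = star c • quatConj A := by
  ext i j; fin_cases i <;> fin_cases j <;> simp [quatConj]

theorem quatConj_mul (A B : M2) : quatConj (A * B) = quatConj A * quatConj B := by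
  ext i j; fin_cases i <;> fin_cases j <;>
    simp [quatConj, Matrix.mul_apply, Fin.sum_univ_two] <;> ring

@[simp] theorem quatConj_quatConj (A : M2) : quatConj (quatConj A) = A := by
  ext i j; fin_cases i <;> fin_cases j <;> simp [quatConj]

@[simp] theorem quatConj_diag (a b : ℂ) :
    quatConj !![a, 0; 0, b] = !![star b, 0; 0, star a] := by
  simp [quatConj]

/-- A unitary matrix fixed by `quatConj`, that is, an element of `SU(2)`. -/
structure IsSpecialUnitary (U : M2) : Prop where
  mem : U ∈ Matrix.unitaryGroup (Fin 2) ℂ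
  conj : quatConj U = U

theorem IsSpecialUnitary.mul {U V : M2} (hU : IsSpecialUnitary U) (hV : IsSpecialUnitary V) :
    IsSpecialUnitary (U * V) :=
  ⟨mul_mem hU.mem hV.mem, by rw [quatConj_mul, hU.conj, hV.conj]⟩

theorem conjTranspose_mem_unitaryGroup {U : M2} (hU : U ∈ Matrix.unitaryGroup (Fin 2) ℂ) :
    U.conjTranspose ∈ Matrix.unitaryGroup (Fin 2) ℂ :=
  Unitary.star_mem hU

theorem conjTranspose_mul_of_mem {U : M2} (hU : U ∈ Matrix.unitaryGroup (Fin 2) ℂ) :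
    U.conjTranspose * U = 1 := Matrix.mem_unitaryGroup_iff'.mp hU

theorem mul_conjTranspose_of_mem {U : M2} (hU : U ∈ Matrix.unitaryGroup (Fin 2) ℂ) :
    U * U.conjTranspose = 1 := Matrix.mem_unitaryGroup_iff.mp hU

theorem IsSpecialUnitary.conjTranspose {U : M2} (hU : IsSpecialUnitary U) :
    IsSpecialUnitary U.conjTranspose := by
  refine ⟨conjTranspose_mem_unitaryGroup hU.mem, ?_⟩
  have h : quatConj U.conjTranspose = (quatConj U).conjTranspose := by
    ext i j; fin_cases i <;> fin_cases j <;> simp [quatConj]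
  rw [h, hU.conj]

/-! ### Parallel pairs and simultaneous singular value decompositions -/

/-- The special unitary matrix with a prescribed first column. -/
def unitaryOfCol (y : EuclideanSpace ℂ (Fin 2)) : M2 := !![y 0, -star (y 1); y 1, star (y 0)]

/-- Determinant one matters: such factors are fixed by `quatConj`, which therefore acts on `U * D *
V` through `D` alone. -/
theorem isSpecialUnitary_unitaryOfCol {y : EuclideanSpace ℂ (Fin 2)} (hy : ‖y‖ = 1) :
    IsSpecialUnitary (unitaryOfCol y) := by
  have h := EuclideanSpace.norm_sq_eq y
  rw [hy, Fin.sum_univ_two] at h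
  have h' : star (y 0) * y 0 + star (y 1) * y 1 = 1 := by
    simp only [Complex.star_def, Complex.conj_mul']
    exact_mod_cast h.symm.trans (by norm_num)
  refine ⟨?_, by simp [quatConj, unitaryOfCol]⟩
  rw [Matrix.mem_unitaryGroup_iff']
  simp only [Complex.star_def] at h'
  ext i j; fin_cases i <;> fin_cases j <;>
    simp [unitaryOfCol, Matrix.mul_apply, Matrix.star_apply, Fin.sum_univ_two] <;>
    first | ring1 | linear_combination h'

/-- Triangle equality attaining pairs have a simultaneous singular value decomposition. -/
theorem IsTEAPair.exists_svd {A B : M2} (h : IsTEAPair A B) :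
    ∃ U V : M2, IsSpecialUnitary U ∧ IsSpecialUnitary V ∧ ∃ a b : ℂ, ‖a‖ ≤ ‖A‖ ∧ ‖b‖ ≤ ‖B‖ ∧
      A = U * !![(‖A‖ : ℂ), 0; 0, a] * V ∧ B = U * !![(‖B‖ : ℂ), 0; 0, b] * V := by
  have hAB : ‖Matrix.toEuclideanCLM (n := Fin 2) (𝕜 := ℂ) A + Matrix.toEuclideanCLM (n := Fin 2) (𝕜 := ℂ) B‖ =
      ‖Matrix.toEuclideanCLM (n := Fin 2) (𝕜 := ℂ) A‖ +
      ‖Matrix.toEuclideanCLM (n := Fin 2) (𝕜 := ℂ) B‖ := by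
    rw [← map_add]; exact h
  obtain ⟨x, y, hx, hy, hA, hB⟩ := ContinuousLinearMap.exists_common_direction _ _ hAB
  rw [Matrix.l2_opNorm_toEuclideanCLM] at hA hB
  have hU := isSpecialUnitary_unitaryOfCol hy
  have hW := isSpecialUnitary_unitaryOfCol hx
  have key : ∀ M : M2, Matrix.toEuclideanCLM (n := Fin 2) (𝕜 := ℂ) M x = (‖M‖ : ℂ) • y →
      ∃ m : ℂ, ‖m‖ ≤ ‖M‖ ∧
        M = unitaryOfCol y * !![(‖M‖ : ℂ), 0; 0, m] * (unitaryOfCol x).conjTranspose := by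
    intro M hM
    -- `N` is `M` in orthonormal bases starting with `x` and `y`; its first column is `(‖M‖, 0)`,
    -- which leaves no room for an off-diagonal entry.
    set N := (unitaryOfCol y).conjTranspose * M * unitaryOfCol x with hN
    have hnorm : ‖N‖ = ‖M‖ := norm_unitary_mul_mul hU.conjTranspose.mem hW.mem M
    have e0 := congrArg (fun v : EuclideanSpace ℂ (Fin 2) => v 0) hM
    have e1 := congrArg (fun v : EuclideanSpace ℂ (Fin 2) => v 1) hM
    simp [Matrix.mulVec, dotProduct, Fin.sum_univ_two] at e0 e1
    have hyy : star (y 0) * y 0 + star (y 1) * y 1 = 1 := by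
      have h := congrFun (congrFun (conjTranspose_mul_of_mem hU.mem) 0) 0
      simpa [unitaryOfCol, Matrix.mul_apply, Fin.sum_univ_two] using h
    simp only [Complex.star_def] at hyy
    have h00 : N 0 0 = ‖M‖ := by
      simp [hN, unitaryOfCol, Matrix.mul_apply, Fin.sum_univ_two]
      linear_combination (starRingEnd ℂ (y 0)) * e0 + (starRingEnd ℂ (y 1)) * e1 + ‖M‖ * hyy
    have h10 : N 1 0 = 0 := by
      simp [hN, unitaryOfCol, Matrix.mul_apply, Fin.sum_univ_two]
      linear_combination - (y 1) * e0 + (y 0) * e1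
    obtain ⟨hd, hle⟩ := eq_diag_of_norm_le h10 (by rw [h00, hnorm]; simp)
    refine ⟨N 1 1, by simpa [h00] using hle, ?_⟩
    rw [h00] at hd
    rw [← hd, hN]
    calc M = (unitaryOfCol y * (unitaryOfCol y).conjTranspose) * M *
          (unitaryOfCol x * (unitaryOfCol x).conjTranspose) := by
            rw [mul_conjTranspose_of_mem hU.mem, mul_conjTranspose_of_mem hW.mem]; simp
      _ = _ := by simp only [mul_assoc]
  obtain ⟨a, ha, hA'⟩ := key A hA
  obtain ⟨b, hb, hB'⟩ := key B hB
  exact ⟨_, _, hU, hW.conjTranspose, a, b, ha, hb, hA', hB'⟩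

theorem exists_svd (A : M2) : ∃ U V : M2, IsSpecialUnitary U ∧ IsSpecialUnitary V ∧
    ∃ a b : ℂ, ‖b‖ ≤ ‖a‖ ∧ A = U * !![a, 0; 0, b] * V := by
  have h : IsTEAPair A A := by
    rw [IsTEAPair, ← two_smul ℂ A, norm_smul]
    simp [two_mul]
  obtain ⟨U, V, hU, hV, a, -, ha, -, hA, -⟩ := h.exists_svd
  exact ⟨U, V, hU, hV, ‖A‖, a, by simpa using ha, hA⟩

theorem Complex.exists_phase (z : ℂ) : ∃ ν : ℂ, ‖ν‖ = 1 ∧ ‖z‖ * ν = z :=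
  ⟨_, Complex.norm_exp_ofReal_mul_I z.arg, Complex.norm_mul_exp_arg_mul_I z⟩

theorem Complex.isParallelPair (a b : ℂ) : IsParallelPair ℂ a b := by
  obtain ⟨ν, hν, ha⟩ := Complex.exists_phase a
  obtain ⟨ρ, hρ, hb⟩ := Complex.exists_phase b
  have hρρ : star ρ * ρ = 1 := by
    simp [Complex.conj_mul', hρ]
  refine ⟨ν * star ρ, by simp [hν, hρ], ?_⟩
  have : a + (ν * star ρ) • b = ((‖a‖ + ‖b‖ : ℝ) : ℂ) * ν := by
    conv_lhs => rw [← ha, ← hb]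
    rw [smul_eq_mul]; push_cast
    linear_combination (ν * ‖b‖) * hρρ
  rw [this, norm_mul, hν, Complex.norm_real, mul_one, Real.norm_of_nonneg (by positivity)]

theorem isParallelPair_of_svd {U V : M2} (hU : U ∈ Matrix.unitaryGroup (Fin 2) ℂ)
    (hV : V ∈ Matrix.unitaryGroup (Fin 2) ℂ) {a₁ a₂ b₁ b₂ : ℂ} (ha : ‖a₂‖ ≤ ‖a₁‖)
    (hb : ‖b₂‖ ≤ ‖b₁‖) :
    IsParallelPair ℂ (U * !![a₁, 0; 0, a₂] * V) (U * !![b₁, 0; 0, b₂] * V) := by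
  obtain ⟨μ, hμ, h⟩ := Complex.isParallelPair a₁ b₁
  refine ⟨μ, hμ, ?_⟩
  have e : U * !![a₁, 0; 0, a₂] * V + μ • (U * !![b₁, 0; 0, b₂] * V) =
      U * !![a₁ + μ • b₁, 0; 0, a₂ + μ • b₂] * V := by
    rw [← Matrix.smul_mul, ← Matrix.mul_smul, ← add_mul, ← mul_add]
    simp
  have h2 : ‖a₂ + μ • b₂‖ ≤ ‖a₁ + μ • b₁‖ := by
    rw [h]
    refine (norm_add_le _ _).trans ?_
    rw [norm_smul, hμ, one_mul]
    exact add_le_add ha hb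
  rw [e]
  simp only [norm_unitary_mul_mul hU hV, norm_diag]
  rw [max_eq_left h2, max_eq_left ha, max_eq_left hb, h]

theorem isParallelPair_of_svd' {U V : M2} (hU : U ∈ Matrix.unitaryGroup (Fin 2) ℂ)
    (hV : V ∈ Matrix.unitaryGroup (Fin 2) ℂ) {a₁ a₂ b₁ b₂ : ℂ} (ha : ‖a₁‖ ≤ ‖a₂‖)
    (hb : ‖b₁‖ ≤ ‖b₂‖) :
    IsParallelPair ℂ (U * !![a₁, 0; 0, a₂] * V) (U * !![b₁, 0; 0, b₂] * V) := by
  have hP : !![(0 : ℂ), 1; 1, 0] ∈ Matrix.unitaryGroup (Fin 2) ℂ := by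
    rw [Matrix.mem_unitaryGroup_iff]
    ext i j; fin_cases i <;> fin_cases j <;>
      simp [Matrix.mul_apply, Fin.sum_univ_two, Matrix.star_apply]
  have e : ∀ c₁ c₂ : ℂ, U * !![c₁, 0; 0, c₂] * V =
      (U * !![0, 1; 1, 0]) * !![c₂, 0; 0, c₁] * (!![0, 1; 1, 0] * V) := by
    intro c₁ c₂
    have : !![c₁, 0; 0, c₂] = !![0, 1; 1, 0] * !![c₂, 0; 0, c₁] * !![0, 1; 1, 0] := by
      simp
    rw [this]; simp only [mul_assoc]
  rw [e, e]
  exact isParallelPair_of_svd (mul_mem hU hP) (mul_mem hP hV) ha hb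

theorem IsParallelPair.exists_svd {A B : M2} (h : IsParallelPair ℂ A B) :
    ∃ U V : M2, IsSpecialUnitary U ∧ IsSpecialUnitary V ∧ ∃ a₁ a₂ b₁ b₂ : ℂ,
      ‖a₂‖ ≤ ‖a₁‖ ∧ ‖b₂‖ ≤ ‖b₁‖ ∧
      A = U * !![a₁, 0; 0, a₂] * V ∧ B = U * !![b₁, 0; 0, b₂] * V := by
  obtain ⟨μ, hμ, h⟩ := h
  have hn : ‖μ • B‖ = ‖B‖ := by rw [norm_smul, hμ, one_mul]
  have h' : IsTEAPair A (μ • B) := by rw [IsTEAPair, h, hn]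
  have hμ0 : μ ≠ 0 := by rintro rfl; simp at hμ
  obtain ⟨U, V, hU, hV, a, b, ha, hb, hA, hB⟩ := h'.exists_svd
  refine ⟨U, V, hU, hV, ‖A‖, a, μ⁻¹ * ‖μ • B‖, μ⁻¹ * b, by simpa using ha, ?_, hA, ?_⟩
  · simpa [norm_mul, hμ] using hb
  · calc B = μ⁻¹ • (μ • B) := (inv_smul_smul₀ hμ0 B).symm
      _ = μ⁻¹ • (U * !![(‖μ • B‖ : ℂ), 0; 0, b] * V) := congrArg _ hB
      _ = _ := by
        rw [← Matrix.smul_mul, ← Matrix.mul_smul]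
        simp

/-- The strict inequality makes the first basis vector, up to phase, the only unit vector at which
the diagonal matrix attains its norm, so `B` must attain its norm there too, with the same image
direction. -/
theorem IsParallelPair.eq_diag {a₁ a₂ : ℂ} {B : M2} (ha : ‖a₂‖ < ‖a₁‖)
    (h : IsParallelPair ℂ !![a₁, 0; 0, a₂] B) :
    B = !![B 0 0, 0; 0, B 1 1] ∧ ‖B 1 1‖ ≤ ‖B 0 0‖ := by
  obtain ⟨μ, hμ, h⟩ := h
  have hn : ‖μ • B‖ = ‖B‖ := by rw [norm_smul, hμ, one_mul]
  have hμ0 : μ ≠ 0 := by rintro rfl; simp at hμ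
  have hAB : ‖Matrix.toEuclideanCLM (n := Fin 2) (𝕜 := ℂ) !![a₁, 0; 0, a₂] +
        Matrix.toEuclideanCLM (n := Fin 2) (𝕜 := ℂ) (μ • B)‖ =
      ‖Matrix.toEuclideanCLM (n := Fin 2) (𝕜 := ℂ) !![a₁, 0; 0, a₂]‖ +
      ‖Matrix.toEuclideanCLM (n := Fin 2) (𝕜 := ℂ) (μ • B)‖ := by
    rw [← map_add]
    simp only [Matrix.l2_opNorm_toEuclideanCLM]
    rw [h, hn]
  obtain ⟨x, y, hx, hy, hA, hB⟩ := ContinuousLinearMap.exists_common_direction _ _ hAB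
  rw [Matrix.l2_opNorm_toEuclideanCLM] at hA hB
  rw [norm_diag, max_eq_left ha.le] at hA
  have e0 := congrArg (fun v : EuclideanSpace ℂ (Fin 2) => v 0) hA
  have e1 := congrArg (fun v : EuclideanSpace ℂ (Fin 2) => v 1) hA
  have f0 := congrArg (fun v : EuclideanSpace ℂ (Fin 2) => v 0) hB
  have f1 := congrArg (fun v : EuclideanSpace ℂ (Fin 2) => v 1) hB
  simp [Matrix.mulVec, dotProduct, Fin.sum_univ_two] at e0 e1 f0 f1
  have hx2 := EuclideanSpace.norm_sq_eq x
  have hy2 := EuclideanSpace.norm_sq_eq y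
  rw [hx, Fin.sum_univ_two] at hx2
  rw [hy, Fin.sum_univ_two] at hy2
  have hpos : 0 < ‖a₁‖ := (norm_nonneg _).trans_lt ha
  have n0 := congrArg norm e0
  have n1 := congrArg norm e1
  simp only [norm_mul, Complex.norm_real, norm_norm] at n0 n1
  have h0 : ‖x 0‖ = ‖y 0‖ := mul_left_cancel₀ hpos.ne' n0
  have h1 : ‖x 1‖ = ‖y 1‖ := by
    rw [← abs_norm (x 1), ← abs_norm (y 1), ← sq_eq_sq_iff_abs_eq_abs]
    rw [h0] at hx2; linarith
  have y1 : ‖y 1‖ = 0 := by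
    rw [h1] at n1
    by_contra hne
    exact ha.ne (mul_right_cancel₀ hne n1)
  rw [y1] at h1
  have hx1 : x 1 = 0 := norm_eq_zero.mp h1
  have hy1 : y 1 = 0 := norm_eq_zero.mp y1
  have hy0 : ‖y 0‖ = 1 := by
    rw [y1] at hy2; nlinarith [norm_nonneg (y 0)]
  have hx0 : x 0 ≠ 0 := by
    rw [← norm_ne_zero_iff, h0, hy0]; exact one_ne_zero
  rw [hx1] at f0 f1
  rw [hy1] at f1
  have hB10 : B 1 0 = 0 := by simpa [hμ0, hx0] using f1
  refine eq_diag_of_norm_le hB10 ?_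
  have := congrArg norm f0
  simp [hμ, h0, hy0] at this
  rw [this, hn]

/-! ### Quaternions and maps that are real on them -/

/-- Two quaternions have a simultaneous diagonalization. -/
theorem exists_simultaneous_diag {X Y : M2} (hX : quatConj X = X) (hY : quatConj Y = Y) :
    ∃ U V : M2, IsSpecialUnitary U ∧ IsSpecialUnitary V ∧ ∃ p q : ℂ, 0 ≤ (star p * q).im ∧
      X = U * !![p, 0; 0, star p] * V ∧ Y = U * !![q, 0; 0, star q] * V := by
  -- One decomposition suffices: applying `quatConj` to that of X − iY gives one of X + iY with the
  -- same `U`, `V`. Then `p` and `q` come from half the sum and half the difference, and Im(p̄q) =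
  -- (|a|² − |b|²)/4 ≥ 0.
  obtain ⟨U, V, hU, hV, a, b, hab, hA⟩ := _root_.exists_svd (X - Complex.I • Y)
  have hJ : quatConj (X - Complex.I • Y) = X + Complex.I • Y := by
    rw [sub_eq_add_neg, ← neg_smul, quatConj_add, quatConj_smul, hX, hY]
    simp
  have hA' := congrArg quatConj hA
  rw [hJ, quatConj_mul, quatConj_mul, hU.conj, hV.conj, quatConj_diag] at hA'
  refine ⟨U, V, hU, hV, (a + star b) / 2, Complex.I / 2 * (a - star b), ?_, ?_, ?_⟩
  · have h2 : ‖b‖ ^ 2 ≤ ‖a‖ ^ 2 := pow_le_pow_left₀ (norm_nonneg _) hab 2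
    rw [← Complex.normSq_eq_norm_sq, ← Complex.normSq_eq_norm_sq, Complex.normSq_apply,
      Complex.normSq_apply] at h2
    simp
    nlinarith
  · have : X = (1 / 2 : ℂ) • ((X - Complex.I • Y) + (X + Complex.I • Y)) := by
      module
    rw [this, hA', hA, ← add_mul, ← mul_add, ← Matrix.smul_mul, ← Matrix.mul_smul]
    congr 2
    simp; constructor <;> ring
  · have : Y = (Complex.I / 2) • ((X - Complex.I • Y) - (X + Complex.I • Y)) := by
      rw [show (X - Complex.I • Y) - (X + Complex.I • Y) = (-(2 * Complex.I)) • Y by module,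
        smul_smul, show Complex.I / 2 * -(2 * Complex.I) = -(Complex.I * Complex.I) by ring,
        Complex.I_mul_I, neg_neg, one_smul]
    rw [this, hA', hA, ← sub_mul, ← mul_sub, ← Matrix.smul_mul, ← Matrix.mul_smul]
    congr 2
    ext i j
    fin_cases i <;> fin_cases j <;> simp <;> ring

theorem smul_mul_mul (c : ℂ) (U A V : M2) : c • (U * A * V) = U * (c • A) * V := by
  rw [Matrix.mul_smul, Matrix.smul_mul]

/-- The squared norms differ by (|a₁|² − |a₂|²) Im(p̄q). The second factor does not depend on a₁,
a₂, so both members of a pair keep their dominant entry in the same position. -/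
theorem norm_combination_le {a₁ a₂ p q : ℂ} (ha : ‖a₂‖ ≤ ‖a₁‖) (h : 0 ≤ (star p * q).im) :
    ‖(a₁ + a₂) / 2 * star p + -Complex.I / 2 * (a₁ - a₂) * star q‖ ≤
      ‖(a₁ + a₂) / 2 * p + -Complex.I / 2 * (a₁ - a₂) * q‖ := by
  have h2 : ‖a₂‖ ^ 2 ≤ ‖a₁‖ ^ 2 := pow_le_pow_left₀ (norm_nonneg _) ha 2
  refine abs_le_of_sq_le_sq' ?_ (norm_nonneg _) |>.2
  have key : ‖(a₁ + a₂) / 2 * p + -Complex.I / 2 * (a₁ - a₂) * q‖ ^ 2 -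
      ‖(a₁ + a₂) / 2 * star p + -Complex.I / 2 * (a₁ - a₂) * star q‖ ^ 2 =
      (‖a₁‖ ^ 2 - ‖a₂‖ ^ 2) * (star p * q).im := by
    simp only [← Complex.normSq_eq_norm_sq, Complex.normSq_apply]
    simp
    ring
  nlinarith [mul_nonneg (sub_nonneg.mpr h2) h]

/-- A complex linear map which sends quaternions to quaternions preserves parallel pairs. -/
theorem preservesParallelPairs_of_quatConj {T : M2 →ₗ[ℂ] M2}
    (h : ∀ X, quatConj X = X → quatConj (T X) = T X) : PreservesParallelPairs T := by
  intro A B hAB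
  obtain ⟨U, V, hU, hV, a₁, a₂, b₁, b₂, ha, hb, rfl, rfl⟩ := hAB.exists_svd
  -- The quaternions `U * V` and `U * diag(i, -i) * V` span over ℂ all matrices `U * D * V` with `D`
  -- diagonal, so diagonalizing their two images diagonalizes the image of every such matrix.
  have hX : quatConj (U * V) = U * V := (hU.mul hV).conj
  have hY : quatConj (U * !![Complex.I, 0; 0, -Complex.I] * V) =
      U * !![Complex.I, 0; 0, -Complex.I] * V := by
    rw [quatConj_mul, quatConj_mul, hU.conj, hV.conj, quatConj_diag]
    simp
  obtain ⟨U', V', hU', hV', p, q, hpq, hTX, hTY⟩ :=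
    exists_simultaneous_diag (h _ hX) (h _ hY)
  have key : ∀ c₁ c₂ : ℂ, T (U * !![c₁, 0; 0, c₂] * V) =
      U' * !![(c₁ + c₂) / 2 * p + -Complex.I / 2 * (c₁ - c₂) * q, 0; 0,
        (c₁ + c₂) / 2 * star p + -Complex.I / 2 * (c₁ - c₂) * star q] * V' := by
    intro c₁ c₂
    have e : U * !![c₁, 0; 0, c₂] * V = ((c₁ + c₂) / 2) • (U * V) +
        (-Complex.I / 2 * (c₁ - c₂)) • (U * !![Complex.I, 0; 0, -Complex.I] * V) := by
      have : !![c₁, 0; 0, c₂] = ((c₁ + c₂) / 2) • (1 : M2) +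
          (-Complex.I / 2 * (c₁ - c₂)) • !![Complex.I, 0; 0, -Complex.I] := by
        ext i j
        fin_cases i <;> fin_cases j <;> simp <;> ring_nf <;> simp <;> ring
      rw [this, mul_add, add_mul, Matrix.mul_smul, Matrix.mul_smul, Matrix.smul_mul,
        Matrix.smul_mul, mul_one]
    rw [e, map_add, map_smul, map_smul, hTX, hTY]
    rw [smul_mul_mul, smul_mul_mul, ← add_mul, ← mul_add]
    simp
  rw [key, key]
  exact isParallelPair_of_svd hU'.mem hV'.mem (norm_combination_le ha hpq)
    (norm_combination_le hb hpq)

theorem isParallelPair_of_quatConj {X Y : M2} (hX : quatConj X = X) (hY : quatConj Y = Y) :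
    IsParallelPair ℂ X Y := by
  obtain ⟨U, V, hU, hV, p, q, -, hp, hq⟩ := exists_simultaneous_diag hX hY
  rw [hp, hq]
  exact isParallelPair_of_svd hU.mem hV.mem (by simp) (by simp)

/-- After simultaneous diagonalization both entries of `X` have the same modulus, so `X` attains its
norm wherever `X + iY` does. -/
theorem isParallelPair_re {X Y : M2} (hX : quatConj X = X) (hY : quatConj Y = Y) :
    IsParallelPair ℂ X (X + Complex.I • Y) := by
  obtain ⟨U, V, hU, hV, p, q, -, hp, hq⟩ := exists_simultaneous_diag hX hY
  have e : X + Complex.I • Y =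
      U * !![p + Complex.I * q, 0; 0, star p + Complex.I * star q] * V := by
    rw [hp, hq, ← Matrix.smul_mul, ← Matrix.mul_smul, ← add_mul, ← mul_add]
    simp
  rw [e, hp]
  rcases le_total ‖star p + Complex.I * star q‖ ‖p + Complex.I * q‖ with hle | hle
  · exact isParallelPair_of_svd hU.mem hV.mem (by simp) hle
  · exact isParallelPair_of_svd' hU.mem hV.mem (by simp) hle

theorem quatConj_real_smul {X : M2} (hX : quatConj X = X) (t : ℝ) :
    quatConj ((t : ℂ) • X) = (t : ℂ) • X := by
  rw [quatConj_smul, hX]; simp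

theorem quatConj_add_of_fixed {X Y : M2} (hX : quatConj X = X) (hY : quatConj Y = Y) :
    quatConj (X + Y) = X + Y := by
  rw [quatConj_add, hX, hY]

/-- Every matrix is a complex combination of quaternions. -/
theorem exists_quaternion_decomposition (M : M2) :
    ∃ X Y : M2, quatConj X = X ∧ quatConj Y = Y ∧ M = X + Complex.I • Y := by
  refine ⟨(1 / 2 : ℂ) • (M + quatConj M), (-Complex.I / 2 : ℂ) • (M - quatConj M), ?_, ?_, ?_⟩
  · rw [quatConj_smul, quatConj_add, quatConj_quatConj, add_comm]; simp
  · rw [sub_eq_add_neg, ← neg_one_smul ℂ (quatConj M), quatConj_smul, quatConj_add,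
      quatConj_smul, quatConj_quatConj]
    simp
    module
  · rw [smul_smul, show Complex.I * (-Complex.I / 2) = -(Complex.I * Complex.I) / 2 by ring,
      Complex.I_mul_I]
    module

theorem linearMap_ext_quaternion {T S : M2 →ₗ[ℂ] M2}
    (h : ∀ X, quatConj X = X → T X = S X) : T = S := by
  ext1 M
  obtain ⟨X, Y, hX, hY, rfl⟩ := exists_quaternion_decomposition M
  rw [map_add, map_add, map_smul, map_smul, h X hX, h Y hY]

theorem exists_trace_form (f : M2 →ₗ[ℂ] ℂ) : ∃ F : M2, ∀ A, f A = (F * A).trace := by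
  refine ⟨Matrix.of fun i j => f (Matrix.single j i 1), fun A => ?_⟩
  conv_lhs => rw [Matrix.matrix_eq_sum_single A]
  simp only [map_sum, Matrix.trace, Matrix.mul_apply, Matrix.diag_apply, Matrix.of_apply]
  rw [Finset.sum_comm]
  refine Finset.sum_congr rfl fun j _ => Finset.sum_congr rfl fun i _ => ?_
  rw [← mul_one (A i j), ← smul_eq_mul, ← Matrix.smul_single, map_smul]
  simp [mul_comm]

theorem IsParallelPair.mul_mul {U V A B : M2} (hU : U ∈ Matrix.unitaryGroup (Fin 2) ℂ)
    (hV : V ∈ Matrix.unitaryGroup (Fin 2) ℂ) (h : IsParallelPair ℂ A B) :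
    IsParallelPair ℂ (U * A * V) (U * B * V) := by
  obtain ⟨μ, hμ, h⟩ := h
  refine ⟨μ, hμ, ?_⟩
  rw [← Matrix.smul_mul, ← Matrix.mul_smul, ← add_mul, ← mul_add]
  simp only [norm_unitary_mul_mul hU hV, h]

/-! ### The dichotomy: rank one or real up to a phase -/

/-- A linear functional bounded by another one is proportional to it. -/
theorem LinearMap.exists_eq_smul_of_norm_le {E : Type*} [AddCommGroup E] [Module ℂ E]
    {f g : E →ₗ[ℂ] ℂ} (h : ∀ x, ‖g x‖ ≤ ‖f x‖) : ∃ c : ℂ, g = c • f := by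
  by_cases hf : ∃ x, f x ≠ 0
  · obtain ⟨x, hx⟩ := hf
    refine ⟨g x / f x, LinearMap.ext fun y => ?_⟩
    have h0 := h (f x • y - f y • x)
    simp only [map_sub, map_smul, smul_eq_mul, mul_comm (f y), sub_self, norm_zero] at h0
    have h1 := norm_le_zero_iff.mp h0
    simp only [LinearMap.smul_apply, smul_eq_mul]
    field_simp
    linear_combination h1
  · push Not at hf
    refine ⟨0, LinearMap.ext fun y => ?_⟩
    have := h y
    rw [hf y, norm_zero] at this
    simpa using this

theorem normSq_add_real_mul (z w : ℂ) (t : ℝ) :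
    ‖z + t * w‖ ^ 2 = ‖z‖ ^ 2 + 2 * t * (star z * w).re + t ^ 2 * ‖w‖ ^ 2 := by
  simp only [← Complex.normSq_eq_norm_sq, Complex.normSq_apply]
  simp
  ring

theorem nonneg_of_quadratic {a b c : ℝ} {s : ℝ}
    (h : ∀ ε : ℝ, 0 < ε → 0 ≤ a + 2 * (s * ε) * b + (s * ε) ^ 2 * c) : 0 ≤ a := by
  have hc : Filter.Tendsto (fun ε : ℝ => a + 2 * (s * ε) * b + (s * ε) ^ 2 * c)
      (nhdsWithin 0 (Set.Ioi 0)) (nhds a) := by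
    have : Continuous (fun ε : ℝ => a + 2 * (s * ε) * b + (s * ε) ^ 2 * c) := by fun_prop
    simpa using (this.tendsto 0).mono_left nhdsWithin_le_nhds
  exact ge_of_tendsto hc (Filter.eventually_of_mem self_mem_nhdsWithin h)

/-- If a map preserving parallel pairs sends some quaternion to a matrix with distinct singular
values, then it has rank one. -/
theorem exists_rank_one_of_generic {T : M2 →ₗ[ℂ] M2} (hT : PreservesParallelPairs T) {X₀ : M2}
    (hX₀ : quatConj X₀ = X₀) {U V : M2} (hU : U ∈ Matrix.unitaryGroup (Fin 2) ℂ)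
    (hV : V ∈ Matrix.unitaryGroup (Fin 2) ℂ) {a b : ℂ} (hab : ‖b‖ < ‖a‖)
    (h₀ : T X₀ = U * !![a, 0; 0, b] * V) : ∃ F Z : M2, ∀ A, T A = (F * A).trace • Z := by
  let S : M2 →ₗ[ℂ] M2 := twoSidedTransform U.conjTranspose 1 V.conjTranspose 1 T
  have hS : ∀ A, S A = U.conjTranspose * T A * V.conjTranspose := by
    intro A; simp [S, twoSidedTransform]
  have hTS : ∀ A, T A = U * S A * V := by
    intro A
    rw [hS]
    calc T A = (U * U.conjTranspose) * T A * (V.conjTranspose * V) := by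
          rw [mul_conjTranspose_of_mem hU, conjTranspose_mul_of_mem hV]; simp
      _ = _ := by simp only [mul_assoc]
  have hSP : ∀ A B, IsParallelPair ℂ A B → IsParallelPair ℂ (S A) (S B) := by
    intro A B h
    rw [hS, hS]
    exact (hT A B h).mul_mul (conjTranspose_mem_unitaryGroup hU)
      (conjTranspose_mem_unitaryGroup hV)
  have hS₀ : S X₀ = !![a, 0; 0, b] := by
    rw [hS, h₀]
    calc _ = (U.conjTranspose * U) * !![a, 0; 0, b] * (V * V.conjTranspose) := by
          simp only [mul_assoc]
      _ = _ := by rw [mul_conjTranspose_of_mem hV, conjTranspose_mul_of_mem hU]; simp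
  -- Every quaternion is parallel to `X₀`, whose image `diag(a, b)` has a strictly dominant first
  -- entry.
  have hreal : ∀ X, quatConj X = X →
      S X = !![S X 0 0, 0; 0, S X 1 1] ∧ ‖S X 1 1‖ ≤ ‖S X 0 0‖ := by
    intro X hX
    refine IsParallelPair.eq_diag hab ?_
    rw [← hS₀]
    exact hSP _ _ (isParallelPair_of_quatConj hX₀ hX)
  let entry (i j : Fin 2) : M2 →ₗ[ℂ] ℂ := (Matrix.entryLinearMap ℂ ℂ i j).comp S
  let f := entry 0 0
  let g := entry 1 1
  have hdiag : ∀ M, S M = !![f M, 0; 0, g M] := by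
    intro M
    obtain ⟨X, Y, hX, hY, rfl⟩ := exists_quaternion_decomposition M
    have e1 := (hreal X hX).1
    have e2 := (hreal Y hY).1
    have z1 := congrFun (congrFun e1 0) 1
    have z2 := congrFun (congrFun e1 1) 0
    have z3 := congrFun (congrFun e2 0) 1
    have z4 := congrFun (congrFun e2 1) 0
    simp at z1 z2 z3 z4
    ext i j
    fin_cases i <;> fin_cases j <;> simp [f, g, entry, z1, z2, z3, z4]
  have hf₀ : f X₀ = a := by simp [f, entry, hS₀]
  have hg₀ : g X₀ = b := by simp [g, entry, hS₀]
  have hab2 : ‖b‖ ^ 2 < ‖a‖ ^ 2 := pow_lt_pow_left₀ hab (norm_nonneg _) two_ne_zero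
  have hstrict : ∀ X Y, quatConj X = X → quatConj Y = Y → ‖g X‖ ^ 2 < ‖f X‖ ^ 2 →
      ‖g (X + Complex.I • Y)‖ ^ 2 ≤ ‖f (X + Complex.I • Y)‖ ^ 2 := by
    intro X Y hX hY hlt
    have hp := hSP _ _ (isParallelPair_re hX hY)
    rw [hdiag X] at hp
    have := (hp.eq_diag (lt_of_pow_lt_pow_left₀ 2 (norm_nonneg _) hlt)).2
    exact pow_le_pow_left₀ (norm_nonneg _) this 2
  have hle : ∀ M, ‖g M‖ ≤ ‖f M‖ := by
    intro M
    obtain ⟨X, Y, hX, hY, rfl⟩ := exists_quaternion_decomposition M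
    have hXle : ‖g X‖ ^ 2 ≤ ‖f X‖ ^ 2 :=
      pow_le_pow_left₀ (norm_nonneg _) (hreal X hX).2 2
    -- `hstrict` needs strict dominance at `X`. Adding `s * ε` times `X₀` provides it: the sign `s`
    -- makes the linear term in ε of |f|² − |g|² nonnegative, and the quadratic coefficient |a|² −
    -- |b|² is positive. Then ε tends to 0.
    obtain ⟨s, hs, hsb⟩ : ∃ s : ℝ, s ^ 2 = 1 ∧
        0 ≤ s * ((star (f X) * a).re - (star (g X) * b).re) := by
      rcases le_total 0 ((star (f X) * a).re - (star (g X) * b).re) with h | h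
      · exact ⟨1, by norm_num, by linarith⟩
      · exact ⟨-1, by norm_num, by linarith⟩
    refine abs_le_of_sq_le_sq' (sub_nonneg.mp ?_) (norm_nonneg _) |>.2
    refine nonneg_of_quadratic (s := s)
      (b := (star (f (X + Complex.I • Y)) * a).re - (star (g (X + Complex.I • Y)) * b).re)
      (c := ‖a‖ ^ 2 - ‖b‖ ^ 2) fun ε hε => ?_
    have hXt : quatConj (X + ((s * ε : ℝ) : ℂ) • X₀) = X + ((s * ε : ℝ) : ℂ) • X₀ :=
      quatConj_add_of_fixed hX (quatConj_real_smul hX₀ _)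
    have hlt : ‖g (X + ((s * ε : ℝ) : ℂ) • X₀)‖ ^ 2 < ‖f (X + ((s * ε : ℝ) : ℂ) • X₀)‖ ^ 2 := by
      simp only [map_add, map_smul, smul_eq_mul, hf₀, hg₀, normSq_add_real_mul]
      have : (s * ε) ^ 2 = ε ^ 2 := by rw [mul_pow, hs, one_mul]
      rw [this]
      nlinarith [mul_nonneg hε.le hsb, mul_pos (pow_pos hε 2) (sub_pos.mpr hab2)]
    have := hstrict _ Y hXt hY hlt
    rw [add_right_comm] at this
    simp only [map_add _ (X + Complex.I • Y), map_smul _ (((s * ε : ℝ) : ℂ)), smul_eq_mul, hf₀,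
      hg₀, normSq_add_real_mul] at this
    linarith
  obtain ⟨c, hc⟩ := LinearMap.exists_eq_smul_of_norm_le hle
  obtain ⟨F, hF⟩ := exists_trace_form f
  refine ⟨F, U * !![1, 0; 0, c] * V, fun A => ?_⟩
  rw [hTS, hdiag, hc, ← hF, ← Matrix.smul_mul, ← Matrix.mul_smul]
  simp [mul_comm]

/-- `quatConj` turns `diag(a, b)` into `diag(b̄, ā)`, which is proportional to it when the moduli
agree. Used contrapositively: non-proportionality yields distinct singular values. -/
theorem exists_quatConj_eq_smul {U V : M2} (hU : IsSpecialUnitary U) (hV : IsSpecialUnitary V)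
    {a b : ℂ} (hab : ‖a‖ = ‖b‖) :
    ∃ c : ℂ, quatConj (U * !![a, 0; 0, b] * V) = c • (U * !![a, 0; 0, b] * V) := by
  rw [quatConj_mul, quatConj_mul, hU.conj, hV.conj, quatConj_diag]
  by_cases ha : a = 0
  · have hb : b = 0 := by rw [← norm_eq_zero, ← hab, ha, norm_zero]
    refine ⟨0, ?_⟩
    have : !![0, 0; 0, 0] = (0 : M2) := by ext i j; fin_cases i <;> fin_cases j <;> rfl
    rw [ha, hb, star_zero, this]; simp
  · have hb : b ≠ 0 := by rw [← norm_ne_zero_iff, ← hab]; exact norm_ne_zero_iff.mpr ha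
    refine ⟨star b / a, ?_⟩
    rw [← Matrix.smul_mul, ← Matrix.mul_smul]
    congr 2
    have h1 : star a * a = star b * b := by
      simp only [Complex.star_def, Complex.conj_mul', hab]
    ext i j
    fin_cases i <;> fin_cases j <;> simp [ha]
    simp only [Complex.star_def] at h1
    field_simp
    linear_combination h1

/-- Two linear maps which are linearly dependent at each quaternion are linearly dependent, unless
the first has rank at most one. -/
theorem exists_smul_or_rank_one {T S : M2 →ₗ[ℂ] M2}
    (h : ∀ X, quatConj X = X → ∃ c : ℂ, S X = c • T X) :
    (∃ F Z : M2, ∀ A, T A = (F * A).trace • Z) ∨ ∃ c : ℂ, S = c • T := by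
  by_cases hdep : ∃ Z : M2, ∀ X, quatConj X = X → ∃ c : ℂ, T X = c • Z
  · left
    obtain ⟨Z, hZ⟩ := hdep
    have hall : ∀ M, ∃ c : ℂ, T M = c • Z := by
      intro M
      obtain ⟨X, Y, hX, hY, rfl⟩ := exists_quaternion_decomposition M
      obtain ⟨c, hc⟩ := hZ X hX
      obtain ⟨d, hd⟩ := hZ Y hY
      exact ⟨c + Complex.I * d, by rw [map_add, map_smul, hc, hd]; module⟩
    by_cases hZ0 : ∃ i j, Z i j ≠ 0
    · obtain ⟨i, j, hij⟩ := hZ0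
      obtain ⟨F, hF⟩ := exists_trace_form ((Z i j)⁻¹ • (Matrix.entryLinearMap ℂ ℂ i j).comp T)
      refine ⟨F, Z, fun A => ?_⟩
      obtain ⟨c, hc⟩ := hall A
      rw [← hF]
      simp [hc, mul_left_comm, hij]
    · push Not at hZ0
      have : Z = 0 := by ext i j; exact hZ0 i j
      refine ⟨0, 0, fun A => ?_⟩
      obtain ⟨c, hc⟩ := hall A
      simp [hc, this]
  · right
    push Not at hdep
    obtain ⟨X₀, hX₀, h0⟩ := hdep 0
    have hT0 : T X₀ ≠ 0 := fun h => h0 0 (by simp [h])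
    obtain ⟨X₁, hX₁, h1⟩ := hdep (T X₀)
    obtain ⟨c₀, hc₀⟩ := h X₀ hX₀
    -- When `T X` and `T Y` are independent, comparing coefficients in `S (X + Y)` equates the two
    -- scalars.
    have indep : ∀ X Y, quatConj X = X → quatConj Y = Y → T X ≠ 0 → (∀ c : ℂ, T Y ≠ c • T X) →
        ∀ c d : ℂ, S X = c • T X → S Y = d • T Y → c = d := by
      intro X Y hX hY hTX hne c d hc hd
      obtain ⟨e, he⟩ := h (X + Y) (quatConj_add_of_fixed hX hY)
      rw [map_add, map_add, hc, hd] at he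
      have h2 : (d - e) • T Y = (e - c) • T X := by
        rw [sub_smul, sub_smul, sub_eq_sub_iff_add_eq_add, add_comm, he, smul_add, add_comm]
      have hde : d = e := by
        by_contra hde
        refine hne ((d - e)⁻¹ * (e - c)) ?_
        rw [mul_smul, ← h2, inv_smul_smul₀ (sub_ne_zero.mpr hde)]
      rw [hde, sub_self, zero_smul] at h2
      have := (smul_eq_zero.mp h2.symm).resolve_right hTX
      rw [hde]; exact (sub_eq_zero.mp this).symm
    refine ⟨c₀, linearMap_ext_quaternion fun X hX => ?_⟩
    obtain ⟨c₁, hc₁⟩ := h X₁ hX₁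
    obtain ⟨c, hc⟩ := h X hX
    have h01 : c₀ = c₁ := indep _ _ hX₀ hX₁ hT0 h1 _ _ hc₀ hc₁
    rw [LinearMap.smul_apply]
    -- If `T X` is a nonzero multiple of `T X₀`, it is independent of `T X₁`, and the comparison
    -- passes through `X₁`.
    by_cases hTX : ∃ d : ℂ, T X = d • T X₀
    · obtain ⟨d, hd⟩ := hTX
      by_cases hd0 : d = 0
      · rw [hc, hd, hd0]; simp
      · have : ∀ e : ℂ, T X₁ ≠ e • T X := by
          intro e he
          exact h1 (e * d) (by rw [he, hd, smul_smul])
        rw [hc, indep X X₁ hX hX₁ (by rw [hd]; exact smul_ne_zero hd0 hT0) this _ _ hc hc₁, h01]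
    · push Not at hTX
      rw [hc, ← indep X₀ X hX₀ hX hT0 hTX _ _ hc₀ hc]

/-- The conjugate of a linear map by `quatConj`. -/
def quatConjMap (T : M2 →ₗ[ℂ] M2) : M2 →ₗ[ℂ] M2 where
  toFun A := quatConj (T (quatConj A))
  map_add' A B := by rw [quatConj_add, map_add, quatConj_add]
  map_smul' c A := by rw [quatConj_smul, map_smul, quatConj_smul]; simp

/-- A linear map preserving parallel pairs has rank one or is, up to a phase, real with respect to
the quaternions. -/
theorem PreservesParallelPairs.rank_one_or_real {T : M2 →ₗ[ℂ] M2}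
    (hT : PreservesParallelPairs T) :
    (∃ F Z : M2, ∀ A, T A = (F * A).trace • Z) ∨
      ∃ μ : ℂ, ‖μ‖ = 1 ∧ ∀ X, quatConj X = X → quatConj (μ • T X) = μ • T X := by
  by_cases hgen : ∀ X, quatConj X = X → ∃ c : ℂ, quatConj (T X) = c • T X
  · have hS : ∀ X, quatConj X = X → ∃ c : ℂ, quatConjMap T X = c • T X := by
      intro X hX
      simpa [quatConjMap, hX] using hgen X hX
    rcases exists_smul_or_rank_one hS with h | ⟨c, hc⟩
    · exact Or.inl h
    · have hJ : ∀ X, quatConj X = X → quatConj (T X) = c • T X := by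
        intro X hX
        have := LinearMap.congr_fun hc X
        simpa [quatConjMap, hX] using this
      by_cases h0 : T = 0
      · exact Or.inl ⟨0, 0, fun A => by simp [h0]⟩
      · right
        obtain ⟨X, hX, hTX⟩ : ∃ X, quatConj X = X ∧ T X ≠ 0 := by
          by_contra! hcon
          exact h0 (linearMap_ext_quaternion fun X hX => by simp [hcon X hX])
        -- Since `quatConj` is an involution, c̄c = 1. A square root `μ` of `c` is then the required
        -- phase, because μ̄c = μ̄μ² = μ.
        have hcc : star c * c = 1 := by
          have e := congrArg quatConj (hJ X hX)
          rw [quatConj_quatConj, quatConj_smul, hJ X hX, smul_smul] at e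
          have : (star c * c - 1) • T X = 0 := by rw [sub_smul, ← e, one_smul, sub_self]
          exact sub_eq_zero.mp ((smul_eq_zero.mp this).resolve_right hTX)
        obtain ⟨μ, hμ⟩ := IsAlgClosed.exists_pow_nat_eq c (n := 2) two_pos
        have hc1 : ‖c‖ = 1 := by
          have := congrArg norm hcc
          rw [norm_mul, norm_star, norm_one] at this
          nlinarith [norm_nonneg c]
        have hμ1 : ‖μ‖ = 1 := by
          have := congrArg norm hμ
          rw [norm_pow, hc1] at this
          nlinarith [norm_nonneg μ]
        have hμμ : star μ * μ = 1 := by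
          simp [Complex.conj_mul', hμ1]
        refine ⟨μ, hμ1, fun Y hY => ?_⟩
        rw [quatConj_smul, hJ Y hY, smul_smul, ← hμ, sq, ← mul_assoc, hμμ, one_mul]
  · left
    push Not at hgen
    obtain ⟨X₀, hX₀, hne⟩ := hgen
    obtain ⟨U, V, hU, hV, a, b, hab, h⟩ := _root_.exists_svd (T X₀)
    refine exists_rank_one_of_generic hT hX₀ hU.mem hV.mem (lt_of_le_of_ne hab fun heq => ?_) h
    obtain ⟨c, hc⟩ := exists_quatConj_eq_smul hU hV heq.symm
    rw [← h] at hc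
    exact hne c hc

/-! ### Quaternions as Euclidean four-space and their isometries -/

/-- Real four-dimensional Euclidean space. -/
abbrev H4 := EuclideanSpace ℝ (Fin 4)

/-- The quaternion `x₀ + i (x₁ C₁ + x₂ C₂ + x₃ C₃)` as a complex matrix. -/
def quat : H4 →ₗ[ℝ] M2 where
  toFun x := !![x 0 + x 1 * Complex.I, x 3 + x 2 * Complex.I;
    -x 3 + x 2 * Complex.I, x 0 - x 1 * Complex.I]
  map_add' x y := by
    ext i j; fin_cases i <;> fin_cases j <;> simp <;> ring
  map_smul' c x := by
    ext i j; fin_cases i <;> fin_cases j <;> simp <;> ring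

theorem quat_apply (x : H4) : quat x = !![x 0 + x 1 * Complex.I, x 3 + x 2 * Complex.I;
    -x 3 + x 2 * Complex.I, x 0 - x 1 * Complex.I] := rfl

/-- The coordinates of the quaternion part of a matrix. -/
def unquat : M2 →ₗ[ℝ] H4 where
  toFun A := !₂[(A 0 0).re, (A 0 0).im, (A 0 1).im, (A 0 1).re]
  map_add' A B := by ext i; fin_cases i <;> simp
  map_smul' c A := by ext i; fin_cases i <;> simp

theorem unquat_apply (A : M2) :
    unquat A = !₂[(A 0 0).re, (A 0 0).im, (A 0 1).im, (A 0 1).re] := rfl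

@[simp] theorem quatConj_quat (x : H4) : quatConj (quat x) = quat x := by
  simp [quatConj, quat_apply, sub_eq_add_neg, add_comm]

theorem quat_unquat {X : M2} (hX : quatConj X = X) : quat (unquat X) = X := by
  have h1 := congrFun (congrFun hX 1) 0
  have h2 := congrFun (congrFun hX 1) 1
  simp [quatConj] at h1 h2
  ext i j
  fin_cases i <;> fin_cases j <;> simp [quat_apply, unquat_apply, ← h1, ← h2] <;>
    apply Complex.ext <;> simp

theorem linearMap_ext_quat {T S : M2 →ₗ[ℂ] M2} (h : ∀ x, T (quat x) = S (quat x)) : T = S :=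
  linearMap_ext_quaternion fun X hX => by rw [← quat_unquat hX, h]

theorem H4.inner_eq (x y : H4) :
    inner ℝ x y = x 0 * y 0 + x 1 * y 1 + x 2 * y 2 + x 3 * y 3 := by
  simp [PiLp.inner_apply, Fin.sum_univ_four, mul_comm]

theorem trace_quat (x y : H4) : ((quat x).conjTranspose * quat y).trace = 2 * inner ℝ x y := by
  rw [H4.inner_eq]
  apply Complex.ext <;>
    simp [quat_apply, Matrix.trace, Matrix.mul_apply, Fin.sum_univ_two] <;> ring

theorem quat_mem_unitaryGroup {w : H4} (hw : ‖w‖ = 1) :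
    quat w ∈ Matrix.unitaryGroup (Fin 2) ℂ := by
  have h := EuclideanSpace.norm_sq_eq w
  rw [hw, Fin.sum_univ_four] at h
  simp only [Real.norm_eq_abs, sq_abs] at h
  rw [Matrix.mem_unitaryGroup_iff]
  ext i j; fin_cases i <;> fin_cases j <;> apply Complex.ext <;>
    simp [quat_apply, Matrix.mul_apply, Fin.sum_univ_two, Matrix.star_apply] <;>
    first | ring1 | linear_combination -h

/-- A two-sided multiplication by unitary matrices, possibly composed with the transposition. -/
def IsTwoSidedUnitary (f : M2 → M2) : Prop :=
  ∃ U ∈ Matrix.unitaryGroup (Fin 2) ℂ, ∃ V ∈ Matrix.unitaryGroup (Fin 2) ℂ,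
    (∀ A, f A = U * A * V) ∨ (∀ A, f A = U * A.transpose * V)

theorem transpose_mem_unitaryGroup {U : M2} (hU : U ∈ Matrix.unitaryGroup (Fin 2) ℂ) :
    U.transpose ∈ Matrix.unitaryGroup (Fin 2) ℂ := by
  rw [Matrix.mem_unitaryGroup_iff', Matrix.star_eq_conjTranspose,
    show U.transpose.conjTranspose = U.conjTranspose.transpose from rfl, ← Matrix.transpose_mul, mul_conjTranspose_of_mem hU, Matrix.transpose_one]

theorem IsTwoSidedUnitary.comp {f g : M2 → M2} (hf : IsTwoSidedUnitary f)
    (hg : IsTwoSidedUnitary g) : IsTwoSidedUnitary (f ∘ g) := by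
  obtain ⟨U, hU, V, hV, hf⟩ := hf
  obtain ⟨U', hU', V', hV', hg⟩ := hg
  rcases hf with hf | hf
  · refine ⟨U * U', mul_mem hU hU', V' * V, mul_mem hV' hV, ?_⟩
    refine hg.imp (fun hg A => ?_) (fun hg A => ?_) <;>
      simp [hf, hg, mul_assoc]
  · refine ⟨U * V'.transpose, mul_mem hU (transpose_mem_unitaryGroup hV'), U'.transpose * V,
      mul_mem (transpose_mem_unitaryGroup hU') hV, ?_⟩
    refine hg.symm.imp (fun hg A => ?_) (fun hg A => ?_) <;>
      simp [hf, hg, mul_assoc]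

/-- In quaternions the reflection is x ↦ −w x̄ w. With j = `quat (EuclideanSpace.single 3 1)` one
has j xᵗ j = −x̄, which is where the transposition enters. -/
theorem quat_sub_reflection (w x : H4) (hw : ‖w‖ = 1) :
    quat (x - (2 * inner ℝ w x) • w) =
      (quat w * quat (EuclideanSpace.single 3 1)) * (quat x).transpose *
        (quat (EuclideanSpace.single 3 1) * quat w) := by
  have h := EuclideanSpace.norm_sq_eq w
  rw [hw, Fin.sum_univ_four] at h
  simp only [Real.norm_eq_abs, sq_abs] at h
  have ht : (quat x).transpose = !![x 0 + x 1 * Complex.I, -x 3 + x 2 * Complex.I;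
      x 3 + x 2 * Complex.I, x 0 - x 1 * Complex.I] := by
    ext i j; fin_cases i <;> fin_cases j <;> rfl
  rw [H4.inner_eq, ht]
  ext i j; fin_cases i <;> fin_cases j <;> apply Complex.ext <;>
    simp [quat_apply, Matrix.mul_apply, Fin.sum_univ_two]
  · linear_combination (x 0) * h
  · linear_combination (x 1) * h
  · linear_combination (x 3) * h
  · linear_combination (x 2) * h
  · linear_combination (-x 3) * h
  · linear_combination (x 2) * h
  · linear_combination (x 0) * h
  · linear_combination (-x 1) * h

theorem isTwoSidedUnitary_id : IsTwoSidedUnitary id :=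
  ⟨1, one_mem _, 1, one_mem _, Or.inl fun A => by simp⟩

theorem exists_isTwoSidedUnitary_reflection (v : H4) :
    ∃ f, IsTwoSidedUnitary f ∧ ∀ x, quat (Submodule.reflection (Submodule.span ℝ {v})ᗮ x) =
      f (quat x) := by
  by_cases hv : v = 0
  · refine ⟨id, isTwoSidedUnitary_id, fun x => ?_⟩
    rw [Submodule.reflection_orthogonal_apply, Submodule.reflection_singleton_apply, hv]
    simp
  · have hn : ‖v‖ ≠ 0 := norm_ne_zero_iff.mpr hv
    have hw : ‖(‖v‖⁻¹ • v)‖ = 1 := by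
      rw [norm_smul, norm_inv, norm_norm, inv_mul_cancel₀ hn]
    have he : ‖(EuclideanSpace.single 3 1 : H4)‖ = 1 := by simp
    refine ⟨_, ⟨_, mul_mem (quat_mem_unitaryGroup hw) (quat_mem_unitaryGroup he), _,
      mul_mem (quat_mem_unitaryGroup he) (quat_mem_unitaryGroup hw), Or.inr fun _ => rfl⟩,
      fun x => ?_⟩
    rw [← quat_sub_reflection _ _ hw, Submodule.reflection_orthogonal_apply,
      Submodule.reflection_singleton_apply, real_inner_smul_left, smul_smul,
      show 2 * (‖v‖⁻¹ * inner ℝ v x) * ‖v‖⁻¹ = 2 * (inner ℝ v x / ‖v‖ ^ 2) by field_simp]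
    congr 1
    simp only [RCLike.ofReal_real_eq_id, id_eq]
    module

/-- Linear isometries of the quaternions are two-sided multiplications, possibly composed with the
transposition. -/
theorem exists_isTwoSidedUnitary (φ : H4 ≃ₗᵢ[ℝ] H4) :
    ∃ f, IsTwoSidedUnitary f ∧ ∀ x, quat (φ x) = f (quat x) := by
  -- Cartan–Dieudonné: an isometry is a product of hyperplane reflections.
  obtain ⟨l, -, rfl⟩ := φ.reflections_generate_dim
  induction l with
  | nil => exact ⟨id, isTwoSidedUnitary_id, fun x => rfl⟩
  | cons v l ih =>
    obtain ⟨f, hf, hfx⟩ := ih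
    obtain ⟨g, hg, hgx⟩ := exists_isTwoSidedUnitary_reflection v
    refine ⟨g ∘ f, hg.comp hf, fun x => ?_⟩
    rw [List.map_cons, List.prod_cons, Function.comp_apply, ← hfx, ← hgx]
    rfl

/-- Transposition only changes the sign of the last basis quaternion iC₃, so it is absorbed into
`ε`; this is why (b.2) has no transposed variant. -/
theorem OrthonormalBasis.exists_quat_eq (b : OrthonormalBasis (Fin 4) ℝ H4) :
    ∃ U ∈ Matrix.unitaryGroup (Fin 2) ℂ, ∃ V ∈ Matrix.unitaryGroup (Fin 2) ℂ, ∃ ε : Fin 4 → ℝ,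
      (∀ i, ε i * ε i = 1) ∧
      ∀ i, quat (b i) = ε i • (U * quat (EuclideanSpace.single i 1) * V) := by
  obtain ⟨f, ⟨U, hU, V, hV, hf⟩, h⟩ := exists_isTwoSidedUnitary
    ((EuclideanSpace.basisFun (Fin 4) ℝ).equiv b (Equiv.refl _))
  have hb : ∀ i, quat (b i) = f (quat (EuclideanSpace.single i 1)) := by
    intro i
    rw [← h, ← EuclideanSpace.basisFun_apply, OrthonormalBasis.equiv_apply_basis]
    rfl
  rcases hf with hf | hf
  · exact ⟨U, hU, V, hV, fun _ => 1, by simp, fun i => by rw [hb, hf, one_smul]⟩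
  · refine ⟨U, hU, V, hV, ![1, 1, 1, -1], fun i => by fin_cases i <;> simp, fun i => ?_⟩
    have : (quat (EuclideanSpace.single i 1)).transpose =
        (![1, 1, 1, -1] i : ℝ) • quat (EuclideanSpace.single i 1) := by
      ext j k
      fin_cases i <;> fin_cases j <;> fin_cases k <;> simp [quat_apply]
    rw [hb, hf, this, Matrix.mul_smul, Matrix.smul_mul]

/-! ### Normal forms of real linear maps -/

/-- Singular value decomposition of a real linear map. -/
theorem LinearMap.exists_orthonormalBasis_smul {E F : Type*} [NormedAddCommGroup E]
    [InnerProductSpace ℝ E] [FiniteDimensional ℝ E] [NormedAddCommGroup F] [InnerProductSpace ℝ F]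
    [FiniteDimensional ℝ F] {n : ℕ} (hE : Module.finrank ℝ E = n) (hF : Module.finrank ℝ F = n)
    (L : E →ₗ[ℝ] F) : ∃ (b : OrthonormalBasis (Fin n) ℝ E) (b' : OrthonormalBasis (Fin n) ℝ F)
      (d : Fin n → ℝ), ∀ i, L (b i) = d i • b' i := by
  let hs := L.isSymmetric_adjoint_comp_self
  let b := hs.eigenvectorBasis hE
  have horth : ∀ i j, i ≠ j → inner ℝ (L (b i)) (L (b j)) = 0 := by
    intro i j hij
    have h := hs.apply_eigenvectorBasis hE j
    rw [LinearMap.comp_apply] at h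
    rw [← LinearMap.adjoint_inner_right, h, inner_smul_right, b.inner_eq_zero hij, mul_zero]
  -- The nonzero images of the eigenvectors of L*L, normalized, are orthonormal; completing them to
  -- a basis takes care of the kernel.
  have hv : Orthonormal ℝ (Set.domRestrict {i | L (b i) ≠ 0}
      (fun i => (‖L (b i)‖⁻¹ : ℝ) • L (b i))) := by
    constructor
    · rintro ⟨i, hi⟩
      have : ‖L (b i)‖ ≠ 0 := norm_ne_zero_iff.mpr hi
      simp [norm_smul, this]
    · rintro ⟨i, hi⟩ ⟨j, hj⟩ hij
      have hij' : i ≠ j := fun h => hij (Subtype.ext h)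
      simp [inner_smul_left, inner_smul_right, horth i j hij']
  obtain ⟨b', hb'⟩ := hv.exists_orthonormalBasis_extension_of_card_eq (by simp [hF])
  refine ⟨b, b', fun i => ‖L (b i)‖, fun i => ?_⟩
  by_cases hi : L (b i) = 0
  · simp [hi]
  · rw [hb' i hi, smul_inv_smul₀ (norm_ne_zero_iff.mpr hi)]

/-- A linear map preserving orthogonality multiplies norms by a constant. -/
theorem LinearMap.exists_norm_eq_mul {E F : Type*} [NormedAddCommGroup E] [InnerProductSpace ℝ E]
    [NormedAddCommGroup F] [InnerProductSpace ℝ F] [Nontrivial E] (L : E →ₗ[ℝ] F)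
    (h : ∀ x y, inner ℝ x y = 0 → inner ℝ (L x) (L y) = 0) :
    ∃ γ : ℝ, 0 ≤ γ ∧ ∀ x, ‖L x‖ = γ * ‖x‖ := by
  -- Vectors have equal norms exactly when their sum and difference are orthogonal.
  have heq : ∀ x y, ‖x‖ = ‖y‖ → ‖L x‖ = ‖L y‖ := by
    intro x y hxy
    have := h (x + y) (x - y) ((real_inner_add_sub_eq_zero_iff x y).mpr hxy)
    rwa [map_add, map_sub, real_inner_add_sub_eq_zero_iff] at this
  obtain ⟨e, he⟩ := exists_norm_eq E (zero_le_one (α := ℝ))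
  refine ⟨‖L e‖, norm_nonneg _, fun x => ?_⟩
  rw [heq x (‖x‖ • e) (by rw [norm_smul, he, norm_norm, mul_one]), map_smul, norm_smul, norm_norm,
    mul_comm]

/-! ### Maps preserving TEA pairs -/

theorem norm_transpose (A : M2) : ‖A.transpose‖ = ‖A‖ := by
  obtain ⟨U, V, hU, hV, a, b, -, rfl⟩ := exists_svd A
  have : !![a, 0; 0, b].transpose = !![a, 0; 0, b] := by
    ext i j; fin_cases i <;> fin_cases j <;> rfl
  rw [Matrix.transpose_mul, Matrix.transpose_mul, this, ← mul_assoc,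
    norm_unitary_mul_mul (transpose_mem_unitaryGroup hV.mem) (transpose_mem_unitaryGroup hU.mem),
    norm_unitary_mul_mul hU.mem hV.mem]

/-- Multiples of isometries preserve triangle equality attaining pairs. -/
theorem preservesTEAPairs_of_norm_eq {T : M2 →ₗ[ℂ] M2} {γ : ℝ} (h : ∀ A, ‖T A‖ = γ * ‖A‖) :
    PreservesTEAPairs T := by
  intro A B hAB
  rw [IsTEAPair, ← map_add, h, h, h, hAB, mul_add]

theorem PreservesTEAPairs.preservesParallelPairs {T : M2 →ₗ[ℂ] M2} (hT : PreservesTEAPairs T) :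
    PreservesParallelPairs T := by
  rintro A B ⟨μ, hμ, h⟩
  refine ⟨μ, hμ, ?_⟩
  have := hT A (μ • B) (by rw [IsTEAPair, h, norm_smul, hμ, one_mul])
  rwa [IsTEAPair, map_smul, norm_smul μ, hμ, one_mul] at this

/-- Two quaternions `X`, `Y` are orthogonal if and only if `X` and `i Y` form a triangle equality
attaining pair. -/
theorem isTEAPair_quat_iff (x y : H4) :
    IsTEAPair (quat x) (Complex.I • quat y) ↔ inner ℝ x y = 0 := by
  obtain ⟨U, V, hU, hV, p, q, hpq, hx, hy⟩ :=
    exists_simultaneous_diag (quatConj_quat x) (quatConj_quat y)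
  have hinner : inner ℝ x y = (star p * q).re := by
    have h := trace_quat x y
    have e : (quat x).conjTranspose * quat y = V.conjTranspose *
        ((!![p, 0; 0, star p] : M2).conjTranspose * !![q, 0; 0, star q] * V) := by
      rw [hx, hy, Matrix.conjTranspose_mul, Matrix.conjTranspose_mul]
      calc _ = V.conjTranspose * ((!![p, 0; 0, star p] : M2).conjTranspose *
            (U.conjTranspose * U) * !![q, 0; 0, star q] * V) := by simp only [mul_assoc]
        _ = _ := by rw [conjTranspose_mul_of_mem hU.mem, mul_one]
    rw [e, Matrix.trace_mul_comm, mul_assoc, mul_conjTranspose_of_mem hV.mem, mul_one] at h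
    have h' := congrArg Complex.re h
    simp [Matrix.trace, Matrix.mul_apply, Fin.sum_univ_two] at h'
    simp
    linarith
  have hsum : quat x + Complex.I • quat y =
      U * !![p + Complex.I * q, 0; 0, star p + Complex.I * star q] * V := by
    rw [hx, hy, smul_mul_mul, ← add_mul, ← mul_add]
    simp
  have e1 : ‖p + Complex.I * q‖ ^ 2 = ‖p‖ ^ 2 + ‖q‖ ^ 2 - 2 * (star p * q).im := by
    simp only [← Complex.normSq_eq_norm_sq, Complex.normSq_apply]
    simp
    ring
  have e2 : ‖star p + Complex.I * star q‖ ^ 2 = ‖p‖ ^ 2 + ‖q‖ ^ 2 + 2 * (star p * q).im := by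
    simp only [← Complex.normSq_eq_norm_sq, Complex.normSq_apply]
    simp
    ring
  have e3 : (star p * q).re ^ 2 + (star p * q).im ^ 2 = (‖p‖ * ‖q‖) ^ 2 := by
    rw [← norm_star p, ← norm_mul, ← Complex.normSq_eq_norm_sq, Complex.normSq_apply]
    ring
  have hle : ‖p + Complex.I * q‖ ≤ ‖star p + Complex.I * star q‖ :=
    abs_le_of_sq_le_sq' (by linarith) (norm_nonneg _) |>.2
  have hnx : ‖quat x‖ = ‖p‖ := by
    rw [hx, norm_unitary_mul_mul hU.mem hV.mem, norm_diag]; simp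
  have hny : ‖Complex.I • quat y‖ = ‖q‖ := by
    rw [norm_smul, hy, norm_unitary_mul_mul hU.mem hV.mem, norm_diag]; simp
  rw [IsTEAPair, hnx, hny, hsum, norm_unitary_mul_mul hU.mem hV.mem, norm_diag,
    max_eq_right hle, hinner, ← sq_eq_sq₀ (norm_nonneg _) (by positivity), e2]
  -- Equality of norms now reads Im(p̄q) = |p||q|. As Im(p̄q) ≥ 0 and |p̄q| = |p||q|, this means
  -- Re(p̄q) = 0, and that real part is the inner product.
  have hpqn : 0 ≤ ‖p‖ * ‖q‖ := by positivity
  constructor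
  · intro h
    have : (star p * q).im = ‖p‖ * ‖q‖ := by nlinarith
    rw [this] at e3
    exact pow_eq_zero_iff two_ne_zero |>.mp (by linarith)
  · intro h
    rw [h] at e3
    have : (star p * q).im = ‖p‖ * ‖q‖ := (sq_eq_sq₀ hpq hpqn).mp (by linarith)
    rw [this]; ring

theorem Complex.mul_eq_zero_of_norm_add {z w : ℂ} (h₁ : ‖z + w‖ = ‖z‖ + ‖w‖)
    (h₂ : ‖z - w‖ = ‖z‖ + ‖w‖) : z * w = 0 := by
  have h := parallelogram_law_with_norm ℝ z w
  rw [h₁, h₂] at h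
  rw [← norm_eq_zero, norm_mul]
  linarith

/-- A rank one map preserving triangle equality attaining pairs vanishes. -/
theorem PreservesTEAPairs.eq_zero_of_rank_one {T : M2 →ₗ[ℂ] M2} (hT : PreservesTEAPairs T)
    {F Z : M2} (h : ∀ A, T A = (F * A).trace • Z) : T = 0 := by
  by_cases hZ : Z = 0
  · ext1 A; simp [h, hZ]
  have hZn : ‖Z‖ ≠ 0 := norm_ne_zero_iff.mpr hZ
  have hadd : ∀ A B, IsTEAPair A B →
      ‖(F * A).trace + (F * B).trace‖ = ‖(F * A).trace‖ + ‖(F * B).trace‖ := by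
    intro A B hAB
    have := hT A B hAB
    rw [IsTEAPair, h, h, ← add_smul, norm_smul, norm_smul, norm_smul, ← add_mul] at this
    exact mul_right_cancel₀ hZn this
  let g : H4 → ℂ := fun x => (F * quat x).trace
  -- Orthogonality survives y ↦ −y, so both signs give equality in the triangle inequality for two
  -- complex numbers, and one of them must vanish.
  have hg : ∀ x y : H4, inner ℝ x y = 0 → g x * g y = 0 := by
    intro x y hxy
    have h1 := hadd _ _ ((isTEAPair_quat_iff x y).mpr hxy)
    have h2 := hadd _ _ ((isTEAPair_quat_iff x (-y)).mpr (by rw [inner_neg_right, hxy, neg_zero]))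
    rw [map_neg, smul_neg, mul_neg, Matrix.trace_neg, ← sub_eq_add_neg, norm_neg] at h2
    have h3 := Complex.mul_eq_zero_of_norm_add h1 h2
    rw [Matrix.mul_smul, Matrix.trace_smul, smul_eq_mul, mul_left_comm] at h3
    exact (mul_eq_zero.mp h3).resolve_left Complex.I_ne_zero
  refine linearMap_ext_quat fun x => ?_
  rw [h, LinearMap.zero_apply]
  -- This `y` is orthogonal to `x` and of the same norm, so `x + y` and `x - y` are orthogonal as
  -- well: g(x)g(y) = 0 and g(x)² = g(y)², whence g(x) = 0.
  let y : H4 := !₂[-x 1, x 0, -x 3, x 2]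
  have h1 : g x * g y = 0 := hg x y (by rw [H4.inner_eq]; simp [y]; ring)
  have h2 : g (x + y) * g (x - y) = 0 := hg _ _ (by
    rw [H4.inner_eq]; simp [y]; ring)
  have h3 : g (x + y) * g (x - y) = g x * g x - g y * g y := by
    simp only [g, map_add, map_sub, mul_add, mul_sub, Matrix.trace_add, Matrix.trace_sub]
    ring
  have h4 : g x * (g x * g x) = 0 := by linear_combination g x * (h2 - h3) + g y * h1
  have h5 : g x = 0 := by simpa using h4
  change g x • Z = 0
  rw [h5, zero_smul]

/-- The real linear endomorphism of the quaternions induced by a complex linear map. -/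
noncomputable def quatRestrict (S : M2 →ₗ[ℂ] M2) : H4 →ₗ[ℝ] H4 := unquat ∘ₗ S.restrictScalars ℝ ∘ₗ quat

theorem quat_quatRestrict {S : M2 →ₗ[ℂ] M2} (hS : ∀ X, quatConj X = X → quatConj (S X) = S X)
    (x : H4) : quat (quatRestrict S x) = S (quat x) :=
  quat_unquat (hS _ (quatConj_quat x))

/-- A real map preserving triangle equality attaining pairs is a multiple of a two-sided
multiplication, possibly composed with the transposition. -/
theorem PreservesTEAPairs.exists_of_real {S : M2 →ₗ[ℂ] M2} (hT : PreservesTEAPairs S)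
    (hS : ∀ X, quatConj X = X → quatConj (S X) = S X) :
    ∃ γ : ℝ, 0 ≤ γ ∧ ∃ f, IsTwoSidedUnitary f ∧ ∀ A, S A = (γ : ℂ) • f A := by
  obtain ⟨γ, hγ, hnorm⟩ := (quatRestrict S).exists_norm_eq_mul fun x y hxy => by
    rw [← isTEAPair_quat_iff, quat_quatRestrict hS, quat_quatRestrict hS, ← map_smul]
    exact hT _ _ ((isTEAPair_quat_iff x y).mpr hxy)
  refine ⟨γ, hγ, ?_⟩
  rcases hγ.eq_or_lt with rfl | hpos
  · have : S = 0 := linearMap_ext_quat fun x => by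
      rw [← quat_quatRestrict hS, norm_eq_zero.mp ((hnorm x).trans (zero_mul _))]; simp
    exact ⟨id, isTwoSidedUnitary_id, fun A => by simp [this]⟩
  · let φ : H4 →ₗᵢ[ℝ] H4 := ⟨γ⁻¹ • quatRestrict S, fun x => by
      rw [LinearMap.smul_apply, norm_smul, hnorm, Real.norm_of_nonneg (by positivity),
        inv_mul_cancel_left₀ hpos.ne']⟩
    obtain ⟨f, hf, hfx⟩ := exists_isTwoSidedUnitary (φ.toLinearIsometryEquiv rfl)
    refine ⟨f, hf, ?_⟩
    have hx : ∀ x, S (quat x) = (γ : ℂ) • f (quat x) := by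
      intro x
      rw [← hfx, ← quat_quatRestrict hS, Complex.coe_smul, ← map_smul]
      change _ = quat (γ • γ⁻¹ • quatRestrict S x)
      rw [smul_inv_smul₀ hpos.ne']
    -- Agreement is known on quaternions only; either explicit form of `f` is complex linear, so it
    -- extends to all matrices.
    obtain ⟨U, hU, V, hV, hf | hf⟩ := hf
    · have : S = (γ : ℂ) • twoSidedTransform U 1 V 1 LinearMap.id :=
        linearMap_ext_quat fun x => by rw [hx, hf]; simp [twoSidedTransform]
      intro A
      rw [this, hf]; simp [twoSidedTransform]
    · have : S = (γ : ℂ) • twoSidedTransform U 1 V 1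
          (Matrix.transposeLinearEquiv (Fin 2) (Fin 2) ℂ ℂ).toLinearMap :=
        linearMap_ext_quat fun x => by rw [hx, hf]; simp [twoSidedTransform]
      intro A
      rw [this, hf]; simp [twoSidedTransform]

theorem smul_mem_unitaryGroup {μ : ℂ} (hμ : ‖μ‖ = 1) {U : M2}
    (hU : U ∈ Matrix.unitaryGroup (Fin 2) ℂ) : μ • U ∈ Matrix.unitaryGroup (Fin 2) ℂ := by
  rw [Matrix.mem_unitaryGroup_iff', star_smul, Matrix.smul_mul, Matrix.mul_smul, smul_smul,
    Matrix.star_eq_conjTranspose, conjTranspose_mul_of_mem hU]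
  simp [Complex.conj_mul', hμ]

theorem preservesTEAPairs_iff (T : M2 →ₗ[ℂ] M2) :
    PreservesTEAPairs T ↔
      ∃ γ : ℝ, 0 ≤ γ ∧
        ∃ U ∈ Matrix.unitaryGroup (Fin 2) ℂ, ∃ V ∈ Matrix.unitaryGroup (Fin 2) ℂ,
          (∀ A, T A = (γ : ℂ) • (U * A * V)) ∨
          (∀ A, T A = (γ : ℂ) • (U * A.transpose * V)) := by
  constructor
  · intro hT
    rcases hT.preservesParallelPairs.rank_one_or_real with ⟨F, Z, h⟩ | ⟨μ, hμ, h⟩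
    · have := hT.eq_zero_of_rank_one h
      exact ⟨0, le_rfl, 1, one_mem _, 1, one_mem _, Or.inl fun A => by simp [this]⟩
    · have hS : PreservesTEAPairs (μ • T) := by
        intro A B hAB
        simp only [IsTEAPair, LinearMap.smul_apply, ← smul_add, norm_smul, hμ, one_mul]
        exact hT A B hAB
      obtain ⟨γ, hγ, f, ⟨U, hU, V, hV, hf⟩, hfT⟩ := hS.exists_of_real h
      have hμ0 : μ ≠ 0 := by rintro rfl; simp at hμ
      have hTf : ∀ A, T A = (γ : ℂ) • (μ⁻¹ • f A) := by
        intro A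
        rw [smul_comm, ← hfT, LinearMap.smul_apply, inv_smul_smul₀ hμ0]
      refine ⟨γ, hγ, μ⁻¹ • U, smul_mem_unitaryGroup (by rw [norm_inv, hμ, inv_one]) hU, V, hV, ?_⟩
      refine hf.imp (fun hf A => ?_) (fun hf A => ?_) <;>
        rw [hTf, hf, Matrix.smul_mul, Matrix.smul_mul]
  · rintro ⟨γ, hγ, U, hU, V, hV, h⟩
    refine preservesTEAPairs_of_norm_eq (γ := γ) fun A => ?_
    rcases h with h | h
    · rw [h, norm_smul, norm_unitary_mul_mul hU hV, Complex.norm_real, Real.norm_of_nonneg hγ]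
    · rw [h, norm_smul, norm_unitary_mul_mul hU hV, norm_transpose, Complex.norm_real,
        Real.norm_of_nonneg hγ]

/-! ### Maps preserving parallel pairs -/

theorem preservesParallelPairs_of_rank_one {T : M2 →ₗ[ℂ] M2} {F Z : M2}
    (h : ∀ A, T A = (F * A).trace • Z) : PreservesParallelPairs T := by
  intro A B _
  obtain ⟨μ, hμ, hAB⟩ := Complex.isParallelPair (F * A).trace (F * B).trace
  refine ⟨μ, hμ, ?_⟩
  rw [h, h, ← smul_assoc, ← add_smul, norm_smul, norm_smul, norm_smul, hAB, add_mul]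

theorem preservesParallelPairs_of_twoSidedTransform {T : M2 →ₗ[ℂ] M2} {U₁ U₂ V₁ V₂ : M2}
    (hU₁ : U₁ ∈ Matrix.unitaryGroup (Fin 2) ℂ) (hU₂ : U₂ ∈ Matrix.unitaryGroup (Fin 2) ℂ)
    (hV₁ : V₁ ∈ Matrix.unitaryGroup (Fin 2) ℂ) (hV₂ : V₂ ∈ Matrix.unitaryGroup (Fin 2) ℂ)
    (h : PreservesParallelPairs (twoSidedTransform U₁ U₂ V₁ V₂ T)) :
    PreservesParallelPairs T := by
  have cancel : ∀ {U V : M2}, U ∈ Matrix.unitaryGroup (Fin 2) ℂ →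
      V ∈ Matrix.unitaryGroup (Fin 2) ℂ → ∀ A : M2,
      U * (U.conjTranspose * A * V.conjTranspose) * V = A := by
    intro U V hU hV A
    calc _ = (U * U.conjTranspose) * A * (V.conjTranspose * V) := by simp only [mul_assoc]
      _ = A := by rw [mul_conjTranspose_of_mem hU, conjTranspose_mul_of_mem hV]; simp
  have cancel' : ∀ {U V : M2}, U ∈ Matrix.unitaryGroup (Fin 2) ℂ →
      V ∈ Matrix.unitaryGroup (Fin 2) ℂ → ∀ A : M2,
      U.conjTranspose * (U * A * V) * V.conjTranspose = A := by
    intro U V hU hV A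
    simpa using cancel (conjTranspose_mem_unitaryGroup hU) (conjTranspose_mem_unitaryGroup hV) A
  intro A B hAB
  have h1 := (h _ _ (hAB.mul_mul (conjTranspose_mem_unitaryGroup hU₂)
    (conjTranspose_mem_unitaryGroup hV₂))).mul_mul (conjTranspose_mem_unitaryGroup hU₁)
    (conjTranspose_mem_unitaryGroup hV₁)
  simpa only [twoSidedTransform, LinearMap.coe_mk, AddHom.coe_mk, cancel hU₂ hV₂,
    cancel' hU₁ hV₁] using h1

theorem quat_single (i : Fin 4) : quat (EuclideanSpace.single i 1) =
    ((Real.sqrt 2 : ℝ) * ![1, Complex.I, Complex.I, Complex.I] i) • normalizedPauli i := by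
  have h2 : ((Real.sqrt 2 : ℝ) : ℂ) ≠ 0 := by simp
  rw [normalizedPauli, smul_smul, mul_right_comm, mul_inv_cancel₀ h2, one_mul]
  ext j k
  fin_cases i <;> fin_cases j <;> fin_cases k <;> simp [quat_apply, pauli]

/-- Passing from the Pauli basis to 1, iC₁, iC₂, iC₃ turns the entries γₖi into −γₖ and fixes the
diagonal. The matrix becomes real, so `S` maps quaternions to quaternions. -/
theorem preservesParallelPairs_of_toMatrix {S : M2 →ₗ[ℂ] M2} {d₀ d₁ d₂ d₃ γ₁ γ₂ γ₃ : ℝ}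
    (h : LinearMap.toMatrix pauliBasis pauliBasis S =
      !![(d₀ : ℂ), γ₁ * Complex.I, γ₂ * Complex.I, γ₃ * Complex.I;
         0, d₁, 0, 0;
         0, 0, d₂, 0;
         0, 0, 0, d₃]) : PreservesParallelPairs S := by
  have hS : ∀ j, S (normalizedPauli j) =
      ∑ i, LinearMap.toMatrix pauliBasis pauliBasis S i j • normalizedPauli i := by
    intro j
    have := pauliBasis.sum_repr (S (pauliBasis j))
    simp only [pauliBasis_apply] at this
    rw [← this]
    simp [LinearMap.toMatrix_apply, pauliBasis_apply]
  have hq : ∀ j, S (quat (EuclideanSpace.single j 1)) = quat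
      (![!₂[d₀, 0, 0, 0], !₂[-γ₁, d₁, 0, 0], !₂[-γ₂, 0, d₂, 0], !₂[-γ₃, 0, 0, d₃]] j) := by
    intro j
    have h2 : ((Real.sqrt 2 : ℝ) : ℂ) ≠ 0 := by simp
    rw [quat_single, map_smul, hS, h, mul_smul]
    simp only [normalizedPauli, ← Finset.smul_sum, smul_comm _ ((Real.sqrt 2 : ℝ) : ℂ)⁻¹ _]
    rw [inv_smul_smul₀ h2]
    ext k l
    fin_cases j <;> fin_cases k <;> fin_cases l <;> apply Complex.ext <;>
      simp [quat_apply, pauli, Fin.sum_univ_four]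
  refine preservesParallelPairs_of_quatConj fun X hX => ?_
  rw [← quat_unquat hX]
  set x := unquat X
  have hx : x = ∑ i, x i • EuclideanSpace.single i (1 : ℝ) := by
    ext j; simp [Finset.sum_apply, Pi.single_apply]
  have hreal : ∀ (r : ℝ) (A : M2), S (r • A) = r • S A := fun r A => by
    rw [← Complex.coe_smul, map_smul, Complex.coe_smul]
  rw [hx]
  simp only [map_sum, map_smul, hreal, hq]
  simp only [← map_smul, ← map_sum, quatConj_quat]

theorem preservesParallelPairs_iff (T : M2 →ₗ[ℂ] M2) :
    PreservesParallelPairs T ↔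
      (∃ F Z : Matrix (Fin 2) (Fin 2) ℂ, ∀ A, T A = (F * A).trace • Z) ∨
      (∃ U₁ ∈ Matrix.unitaryGroup (Fin 2) ℂ, ∃ U₂ ∈ Matrix.unitaryGroup (Fin 2) ℂ,
        ∃ V₁ ∈ Matrix.unitaryGroup (Fin 2) ℂ, ∃ V₂ ∈ Matrix.unitaryGroup (Fin 2) ℂ,
        ∃ d₀ d₁ d₂ d₃ γ₁ γ₂ γ₃ : ℝ,
          LinearMap.toMatrix pauliBasis pauliBasis (twoSidedTransform U₁ U₂ V₁ V₂ T) =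
            !![(d₀ : ℂ), γ₁ * Complex.I, γ₂ * Complex.I, γ₃ * Complex.I;
               0, d₁, 0, 0;
               0, 0, d₂, 0;
               0, 0, 0, d₃]) := by
  constructor
  · intro hT
    refine hT.rank_one_or_real.imp id ?_
    rintro ⟨μ, hμ, h⟩
    obtain ⟨b, b', d, hd⟩ := (quatRestrict (μ • T)).exists_orthonormalBasis_smul
      (finrank_euclideanSpace_fin (n := 4)) (finrank_euclideanSpace_fin (n := 4))
    obtain ⟨U, hU, V, hV, ε, hε, hb⟩ := b.exists_quat_eq
    obtain ⟨U', hU', V', hV', ε', hε', hb'⟩ := b'.exists_quat_eq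
    -- The left unitary absorbs the phase. The singular bases make the matrix diagonal, so all γₖ
    -- can be taken to be 0; the signs `ε`, `ε'` come from possible transpositions.
    refine ⟨μ • U'.conjTranspose, smul_mem_unitaryGroup hμ (conjTranspose_mem_unitaryGroup hU'),
      U, hU, V'.conjTranspose, conjTranspose_mem_unitaryGroup hV', V, hV,
      ε 0 * (d 0 * ε' 0), ε 1 * (d 1 * ε' 1), ε 2 * (d 2 * ε' 2), ε 3 * (d 3 * ε' 3),
      0, 0, 0, ?_⟩
    set S := twoSidedTransform (μ • U'.conjTranspose) U V'.conjTranspose V T with hS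
    have key : ∀ i, S (quat (EuclideanSpace.single i 1)) =
        ((ε i * (d i * ε' i) : ℝ) : ℂ) • quat (EuclideanSpace.single i 1) := by
      intro i
      have e1 : U * quat (EuclideanSpace.single i 1) * V = (ε i : ℂ) • quat (b i) := by
        rw [hb, Complex.coe_smul, smul_smul, hε, one_smul]
      have e2 : μ • T (quat (b i)) = ((d i * ε' i : ℝ) : ℂ) •
          (U' * quat (EuclideanSpace.single i 1) * V') := by
        rw [← LinearMap.smul_apply, ← quat_quatRestrict (S := μ • T) h, hd, map_smul, hb', smul_smul,
          Complex.coe_smul]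
      have e3 : U'.conjTranspose * (U' * quat (EuclideanSpace.single i 1) * V') *
          V'.conjTranspose = quat (EuclideanSpace.single i 1) := by
        calc _ = (U'.conjTranspose * U') * quat (EuclideanSpace.single i 1) *
              (V' * V'.conjTranspose) := by simp only [mul_assoc]
          _ = _ := by rw [conjTranspose_mul_of_mem hU', mul_conjTranspose_of_mem hV']; simp
      calc S (quat (EuclideanSpace.single i 1))
          = U'.conjTranspose * (μ • T (U * quat (EuclideanSpace.single i 1) * V)) *
              V'.conjTranspose := by
            simp [hS, twoSidedTransform]
        _ = _ := by
            rw [e1, map_smul, smul_comm, e2, smul_smul, ← smul_mul_mul, e3]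
            push_cast; rfl
    have key' : ∀ i, S (normalizedPauli i) =
        ((ε i * (d i * ε' i) : ℝ) : ℂ) • normalizedPauli i := by
      intro i
      have h0 : ((Real.sqrt 2 : ℝ) * ![1, Complex.I, Complex.I, Complex.I] i : ℂ) ≠ 0 := by
        fin_cases i <;> simp
      have e := key i
      rw [quat_single, map_smul, smul_comm] at e
      exact smul_right_injective _ h0 e
    ext i j
    rw [LinearMap.toMatrix_apply, pauliBasis_apply, key' j, map_smul, ← pauliBasis_apply,
      Module.Basis.repr_self]
    fin_cases i <;> fin_cases j <;> simp
  · rintro (⟨F, Z, h⟩ | ⟨U₁, hU₁, U₂, hU₂, V₁, hV₁, V₂, hV₂, d₀, d₁, d₂, d₃, γ₁, γ₂, γ₃, h⟩)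
    · exact preservesParallelPairs_of_rank_one h
    · exact preservesParallelPairs_of_twoSidedTransform hU₁ hU₂ hV₁ hV₂
        (preservesParallelPairs_of_toMatrix h)
theorem theorem1p2
    (T : Matrix (Fin 2) (Fin 2) ℂ →ₗ[ℂ] Matrix (Fin 2) (Fin 2) ℂ) :
    (PreservesTEAPairs T ↔
      ∃ γ : ℝ, 0 ≤ γ ∧
        ∃ U ∈ Matrix.unitaryGroup (Fin 2) ℂ, ∃ V ∈ Matrix.unitaryGroup (Fin 2) ℂ,
          (∀ A, T A = (γ : ℂ) • (U * A * V)) ∨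
          (∀ A, T A = (γ : ℂ) • (U * A.transpose * V))) ∧
    (PreservesParallelPairs T ↔
      (∃ F Z : Matrix (Fin 2) (Fin 2) ℂ, ∀ A, T A = (F * A).trace • Z) ∨
      (∃ U₁ ∈ Matrix.unitaryGroup (Fin 2) ℂ, ∃ U₂ ∈ Matrix.unitaryGroup (Fin 2) ℂ,
        ∃ V₁ ∈ Matrix.unitaryGroup (Fin 2) ℂ, ∃ V₂ ∈ Matrix.unitaryGroup (Fin 2) ℂ,
        ∃ d₀ d₁ d₂ d₃ γ₁ γ₂ γ₃ : ℝ,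
          LinearMap.toMatrix pauliBasis pauliBasis (twoSidedTransform U₁ U₂ V₁ V₂ T) =
            !![(d₀ : ℂ), γ₁ * Complex.I, γ₂ * Complex.I, γ₃ * Complex.I;
               0, d₁, 0, 0;
               0, 0, d₂, 0;
               0, 0, 0, d₃])) := by
  exact ⟨preservesTEAPairs_iff T, preservesParallelPairs_iff T⟩
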